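/- Let $H_0^2([0,1])$ be the Sobolev space of functions $f$ on $[0,1]$ with $f''\in L^2$ and $f=f'=0$ at $0$ and $1$, with norm $\|f''\|_{L^2}$. Let $$\mathrm{Diff}_0^2([0,1])=\{\varphi=\mathrm{Id}+f:\ f\in H_0^2([0,1]),\ 1+f'>0\},$$ an open subset of $\mathrm{Id}+H_0^2([0,1])$, carry the right-invariant metric $G_\varphi(X,Y)=\int_0^1 (X\circ\varphi^{-1})''\,(Y\circ\varphi^{-1})''\,dx$. For $q\in L^2([0,1])$ and $x\in[0,1]$ put $$\eta(q)(x)=\exp\Big(\int_0^x q\Big),\qquad \varphi(q)(x)=\int_0^x\eta(q)(y)\,dy .$$ Let $Q\subset L^2([0,1])$ be the submanifold $\int_0^1 q=0$, $\int_0^1\eta(q)=1$, with the metric $G(q)(X,Y)=\int_0^1 XY/\eta(q)\,dx$ on $T_qQ=\{X\in L^2:\int_0^1 X=\int_0^1 X\varphi(q)=0\}$. By means of this metric and the $L^2$ pairing, identify the cotangent bundle with $$T^*Q=\Big\{(q,p)\in Q\times L^2([0,1]):\ \int_0^1\eta(q)\,p\,dx=\int_0^1\eta(q)\,\varphi(q)\,p\,dx=0\Big\}.$$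 A geodesic on $[\alpha,\beta]$ ($\alpha<\beta$) is a $C^2$ curve that is a critical point of the energy $\frac12\int_\alpha^\beta G(\dot\gamma,\dot\gamma)\,dt$ under all $C^2$ variations with fixed endpoints. **Theorem.** For $(q,p)\in T^*Q$, write $\eta=\eta(q)$, $\varphi=\varphi(q)$ and consider the first-order system on $T^*Q$, with time derivatives taken in $L^2([0,1])$, $$\begin{cases}\dot q=\eta\,p,\\[2pt] \dot p=-\dfrac12\displaystyle\int_x^1\eta\,p^2\,dy+\begin{bmatrix}1&\varphi\end{bmatrix}H_2^{-1}\begin{bmatrix}a\\ b+c\end{bmatrix},\end{cases}\qquad H_2=\begin{bmatrix}1&1/2\\1/2&1/3\end{bmatrix},\tag{$*$}$$ where $$a=\tfrac12\int_0^1 x\,p^2\circ\varphi^{-1}\,dx,\quad b=\tfrac32\int_0^1\Big(\int_0^x p\circ\varphi^{-1}\,dy\Big)^2dx,\quad c=\tfrac14\int_0^1 x^2\,p^2\circ\varphi^{-1}\,dx .$$ 1. A curve $q:[\alpha,\beta]\to L^2([0,1])$ is a geodesic of $(Q,G)$ if and only if there is a curve $p$ such that $(q,p)$ is a curve in $T^*Q$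 solving $(*)$ on $[\alpha,\beta]$. 2. If $\varphi\in\mathrm{Diff}_0^2([0,1])$ and $q=\partial_x\log\partial_x\varphi$, then $q\in Q$ and $\varphi(q)=\varphi$. A curve $t\mapsto\varphi_t$, $t\in[\alpha,\beta]$, in $\mathrm{Diff}_0^2([0,1])$ is a geodesic of the right-invariant metric if and only if there is a curve $p$ such that $(q,p)$, with $q(t)=\partial_x\log\partial_x\varphi_t$, is a curve in $T^*Q$ solving $(*)$. 3. The right-hand side of $(*)$ is tangent to $T^*Q$, and it is the Hamiltonian vector field of the kinetic energy $\mathcal H(q,p)=\frac12\int_0^1\eta(q)\,p^2\,dx$ for the canonical symplectic form of $T^*Q$ (the restriction of $dq\wedge dp$): it is the only tangent vector $V$ with $(dq\wedge dp)(V,W)=d\mathcal H(W)$ for all $W$ tangent to $T^*Q$ at $(q,p)$. -/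

import Mathlib

open Set Filter Topology MeasureTheory

noncomputable section

namespace DiffGeodesics

/-! ### The space `L²([0,1])` -/

/-- Lebesgue measure on `[0,1]`. -/
abbrev μI : Measure ℝ := volume.restrict (Icc (0 : ℝ) 1)

/-- The Hilbert space `L²([0,1])`. -/
abbrev L2 : Type := Lp ℝ 2 μI

/-! ### The space `H₀²([0,1])` -/

/-- `f ∈ H₀²([0,1])`: the `C¹` representative of `f`, extended by zero to the line.  It is
differentiable (so that `f` and `f'` vanish at `0` and at `1`), and `f'` is absolutely continuous
on `[0,1]` with `f'' ∈ L²([0,1])`. -/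
structure MemH02 (f : ℝ → ℝ) : Prop where
  eq_zero : ∀ x, x ∉ Icc (0 : ℝ) 1 → f x = 0
  differentiable : Differentiable ℝ f
  absCont : AbsolutelyContinuousOnInterval (deriv f) 0 1
  memLp : MemLp (deriv (deriv f)) 2 μI

lemma ae_differentiableAt_of_ac {g : ℝ → ℝ} (hg : AbsolutelyContinuousOnInterval g 0 1) :
    ∀ᵐ x ∂μI, DifferentiableAt ℝ g x := by
  rw [ae_restrict_iff' measurableSet_Icc]
  filter_upwards [hg.ae_differentiableAt] with x hx hx'
  exact hx (by rwa [uIcc_of_le zero_le_one])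

lemma MemH02.deriv2_add {f g : ℝ → ℝ} (hf : MemH02 f) (hg : MemH02 g) :
    deriv (deriv (f + g)) =ᵐ[μI] deriv (deriv f) + deriv (deriv g) := by
  have h1 : deriv (f + g) = deriv f + deriv g := by
    funext x
    exact deriv_add (hf.differentiable x) (hg.differentiable x)
  rw [h1]
  filter_upwards [ae_differentiableAt_of_ac hf.absCont, ae_differentiableAt_of_ac hg.absCont]
    with x hx hy
  exact deriv_add hx hy

lemma MemH02.deriv_smul' {f : ℝ → ℝ} (hf : MemH02 f) (c : ℝ) :
    deriv (c • f) = c • deriv f := by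
  funext x
  exact deriv_const_smul c (hf.differentiable x)

lemma MemH02.deriv2_smul {f : ℝ → ℝ} (hf : MemH02 f) (c : ℝ) :
    deriv (deriv (c • f)) =ᵐ[μI] c • deriv (deriv f) := by
  rw [hf.deriv_smul' c]
  filter_upwards [ae_differentiableAt_of_ac hf.absCont] with x hx
  exact deriv_const_smul c hx

lemma memH02_zero : MemH02 0 := by
  have h : deriv (0 : ℝ → ℝ) = 0 := by
    funext x
    simp
  refine ⟨fun _ _ => rfl, differentiable_const 0, ?_, ?_⟩
  · rw [h]
    exact (contDiff_const (c := (0 : ℝ))).contDiffOn.absolutelyContinuousOnInterval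
  · rw [h, h]
    exact MemLp.zero

/-- `H₀²([0,1])` as a space of functions. -/
def H02Submodule : Submodule ℝ (ℝ → ℝ) where
  carrier := {f | MemH02 f}
  zero_mem' := memH02_zero
  add_mem' := by
    intro f g hf hg
    refine ⟨fun x hx => ?_, hf.differentiable.add hg.differentiable, ?_, ?_⟩
    · simp [hf.eq_zero x hx, hg.eq_zero x hx]
    · have h1 : deriv (f + g) = deriv f + deriv g := by
        funext x
        exact deriv_add (hf.differentiable x) (hg.differentiable x)
      rw [h1]
      exact hf.absCont.add hg.absCont
    · exact (hf.memLp.add hg.memLp).ae_eq (hf.deriv2_add hg).symm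
  smul_mem' := by
    intro c f hf
    refine ⟨fun x hx => ?_, hf.differentiable.const_smul c, ?_, ?_⟩
    · simp [hf.eq_zero x hx]
    · rw [hf.deriv_smul' c]
      exact hf.absCont.const_smul c
    · exact (hf.memLp.const_smul c).ae_eq (hf.deriv2_smul c).symm

/-- The space `H₀²([0,1])`; its norm is introduced below. -/
def H02 : Type := H02Submodule

instance : AddCommGroup H02 := inferInstanceAs (AddCommGroup H02Submodule)
instance : Module ℝ H02 := inferInstanceAs (Module ℝ H02Submodule)
instance : CoeFun H02 (fun _ => ℝ → ℝ) := ⟨fun f => Subtype.val f⟩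

lemma H02.memH02 (f : H02) : MemH02 f := f.2

/-- The second derivative `H₀²([0,1]) → L²([0,1])`. -/
def secondDeriv : H02 →ₗ[ℝ] L2 where
  toFun f := f.memH02.memLp.toLp (deriv (deriv f))
  map_add' f g := by
    rw [← MemLp.toLp_add]
    exact (MemLp.toLp_eq_toLp_iff _ _).2 (f.memH02.deriv2_add g.memH02)
  map_smul' c f := by
    rw [RingHom.id_apply, ← MemLp.toLp_const_smul]
    exact (MemLp.toLp_eq_toLp_iff _ _).2 (f.memH02.deriv2_smul c)

lemma MemH02.apply_zero {f : ℝ → ℝ} (hf : MemH02 f) : f 0 = 0 := by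
  have hc : Tendsto f (𝓝[<] 0) (𝓝 (f 0)) :=
    (hf.differentiable.continuous.tendsto 0).mono_left nhdsWithin_le_nhds
  have hz : Tendsto f (𝓝[<] 0) (𝓝 0) := by
    refine tendsto_const_nhds.congr' ?_
    filter_upwards [self_mem_nhdsWithin] with x hx
    exact (hf.eq_zero x (fun h => absurd h.1 (not_le.2 hx))).symm
  exact tendsto_nhds_unique hc hz

lemma MemH02.deriv_eq_zero {f : ℝ → ℝ} (hf : MemH02 f) : deriv f 0 = 0 := by
  have h1 : Tendsto (slope f 0) (𝓝[<] 0) (𝓝 (deriv f 0)) :=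
    (hasDerivAt_iff_tendsto_slope.1 (hf.differentiable 0).hasDerivAt).mono_left
      (nhdsWithin_mono _ (fun x hx => ne_of_lt hx))
  have h0 := hf.apply_zero
  have h2 : Tendsto (slope f 0) (𝓝[<] 0) (𝓝 0) := by
    refine tendsto_const_nhds.congr' ?_
    filter_upwards [self_mem_nhdsWithin] with x hx
    simp [slope_def_field, h0, hf.eq_zero x (fun h => absurd h.1 (not_le.2 hx))]
  exact tendsto_nhds_unique h1 h2

lemma secondDeriv_injective : Function.Injective secondDeriv := by
  rw [← LinearMap.ker_eq_bot, LinearMap.ker_eq_bot']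
  intro f hf
  have hf' := f.memH02
  have h0 : deriv (deriv f) =ᵐ[μI] 0 := by
    have := (MemLp.coeFn_toLp hf'.memLp).symm
    refine this.trans ?_
    change ⇑(secondDeriv f) =ᵐ[μI] 0
    rw [hf]
    exact Lp.coeFn_zero _ _ _
  have h1 : ∀ x ∈ Icc (0 : ℝ) 1, deriv f x = 0 := by
    intro x hx
    have hac : AbsolutelyContinuousOnInterval (deriv f) 0 x := by
      refine hf'.absCont.mono ?_
      rw [uIcc_of_le hx.1, uIcc_of_le zero_le_one]
      exact Icc_subset_Icc_right hx.2
    have hint := hac.integral_deriv_eq_sub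
    rw [hf'.deriv_eq_zero, sub_zero] at hint
    rw [← hint]
    apply intervalIntegral.integral_zero_ae
    rw [Filter.EventuallyEq, ae_restrict_iff' measurableSet_Icc] at h0
    filter_upwards [h0] with y hy hy'
    rw [uIoc_of_le hx.1] at hy'
    exact hy ⟨hy'.1.le, hy'.2.trans hx.2⟩
  have h2 : ∀ x, (f : ℝ → ℝ) x = 0 := by
    intro x
    by_cases hx : x ∈ Icc (0 : ℝ) 1
    · have hc := (convex_Icc (0 : ℝ) 1).is_const_of_fderivWithin_eq_zero (𝕜 := ℝ)
        (f := (f : ℝ → ℝ)) (fun y _ => (hf'.differentiable y).differentiableWithinAt) ?_ hx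
        (left_mem_Icc.2 zero_le_one)
      · rw [hc, hf'.apply_zero]
      · intro y hy
        rw [(hf'.differentiable y).fderivWithin (uniqueDiffOn_Icc zero_lt_one y hy)]
        ext
        simp [h1 y hy]
    · exact hf'.eq_zero x hx
  exact Subtype.ext (funext h2)

/-- The norm `‖f‖ = ‖f''‖_{L²}` of `H₀²([0,1])`. -/
instance : NormedAddCommGroup H02 :=
  NormedAddCommGroup.induced H02 L2 secondDeriv secondDeriv_injective

instance : NormedSpace ℝ H02 := NormedSpace.induced ℝ H02 L2 secondDeriv

/-! ### The group of diffeomorphisms and its right-invariant metric -/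

/-- The map `Id + f`. -/
def toMap (f : H02) (x : ℝ) : ℝ := x + f x

/-- `Diff₀²([0,1])`; the diffeomorphism `φ = Id + f` is represented by `f ∈ H₀²([0,1])`, so that
this is an open subset of `H₀²([0,1])`, whose tangent spaces are all `H₀²([0,1])`. -/
def Diff02 : Set H02 := {f | ∀ x ∈ Icc (0 : ℝ) 1, 0 < 1 + deriv f x}

/-- The inner product `⟨u, v⟩ = ∫₀¹ u'' v'' dx` of `H₀²([0,1])`. -/
def innerH02 (u v : ℝ → ℝ) : ℝ := ∫ x in (0 : ℝ)..1, deriv (deriv u) x * deriv (deriv v) x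

/-- The right-invariant metric `G_φ(X, Y) = ⟨X ∘ φ⁻¹, Y ∘ φ⁻¹⟩`, where `φ = Id + f`. -/
def rightInvMetric (f X Y : H02) : ℝ :=
  innerH02 (fun y => X (Function.invFun (toMap f) y)) (fun y => Y (Function.invFun (toMap f) y))

lemma memLp_logDeriv {f : H02} (hf : f ∈ Diff02) :
    MemLp (deriv fun x => Real.log (deriv (toMap f) x)) 2 μI := by
  have hf' := f.memH02
  have hd : deriv (toMap f) = fun x => 1 + deriv f x := by
    funext x
    exact ((hasDerivAt_id x).add (hf'.differentiable x).hasDerivAt).deriv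
  have hcont : ContinuousOn (fun x => (1 + deriv f x)⁻¹) (Icc 0 1) := by
    have := hf'.absCont.continuousOn
    rw [uIcc_of_le zero_le_one] at this
    exact (continuousOn_const.add this).inv₀ (fun x hx => (hf x hx).ne')
  obtain ⟨C, hC⟩ := isCompact_Icc.exists_bound_of_continuousOn hcont
  have key : deriv (fun x => Real.log (deriv (toMap f) x)) =ᵐ[μI]
      fun x => (1 + deriv f x)⁻¹ * deriv (deriv f) x := by
    filter_upwards [ae_differentiableAt_of_ac hf'.absCont, ae_restrict_mem measurableSet_Icc]
      with x hx hx'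
    rw [hd]
    have h := ((hx.hasDerivAt.const_add 1).log (hf x hx').ne').deriv
    rw [h, div_eq_inv_mul]
  refine MemLp.ae_eq key.symm ?_
  refine MemLp.of_le_mul (c := C) hf'.memLp ?_ ?_
  · exact (hcont.aestronglyMeasurable measurableSet_Icc).mul hf'.memLp.1
  · filter_upwards [ae_restrict_mem measurableSet_Icc] with x hx
    rw [norm_mul]
    exact mul_le_mul_of_nonneg_right (hC x hx) (norm_nonneg _)

open Classical in
/-- The change of variable `q = ∂ₓ (log ∂ₓφ) ∈ L²([0,1])`, for `φ = Id + f ∈ Diff₀²([0,1])`. -/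
def logDerivCoord (f : H02) : L2 :=
  if hf : f ∈ Diff02 then (memLp_logDeriv hf).toLp _ else 0

/-! ### The submanifold `Q` of `L²([0,1])`, its metric and its cotangent bundle -/

/-- `η(q)(x) = exp (∫₀ˣ q)`, for `x ∈ [0,1]`. -/
def eta (q : L2) (x : ℝ) : ℝ := Real.exp (∫ u in (0 : ℝ)..x, q u)

/-- `φ(q)(x) = ∫₀ˣ η(q)`, for `x ∈ [0,1]`. -/
def phi (q : L2) (x : ℝ) : ℝ := ∫ y in (0 : ℝ)..x, eta q y

/-- The inverse of `φ(q) : [0,1] → [0,1]`. -/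
def phiInv (q : L2) : ℝ → ℝ := Function.invFunOn (phi q) (Icc 0 1)

def Q : Set L2 :=
  {q | (∫ x in (0 : ℝ)..1, q x) = 0 ∧ (∫ x in (0 : ℝ)..1, Real.exp (∫ u in (0 : ℝ)..x, q u)) = 1}

/-- The metric `G(q)(X, Y) = ∫₀¹ X Y / η(q) dx`. -/
def metricQ (q X Y : L2) : ℝ := ∫ x in (0 : ℝ)..1, X x * Y x / eta q x

/-- The cotangent bundle of `Q`.  The tangent space `T_qQ` consists of the `X ∈ L²([0,1])` with
`∫ X = 0` and `∫ X φ(q) = 0`; by the metric, a covector at `q` is `Y ↦ ∫ p Y` for a unique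
`p = X / η(q)` with `X ∈ T_qQ`. -/
def cotangentQ : Set (L2 × L2) :=
  {z | z.1 ∈ Q ∧ (∫ x in (0 : ℝ)..1, eta z.1 x * z.2 x) = 0 ∧
    (∫ x in (0 : ℝ)..1, eta z.1 x * z.2 x * phi z.1 x) = 0}

/-- The kinetic energy on the cotangent bundle: half the squared norm of the covector `p`, that is,
`½ G(q)(X, X)` for `X = η(q) p`. -/
def hamiltonian (z : L2 × L2) : ℝ := (1 / 2) * ∫ x in (0 : ℝ)..1, eta z.1 x * z.2 x ^ 2

/-- The symplectic form `dq ∧ dp`, of which the canonical form of `T*Q` is the restriction. -/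
def symplecticForm (V W : L2 × L2) : ℝ := inner ℝ V.1 W.2 - inner ℝ V.2 W.1

/-! ### Geodesics -/

section Geodesics

variable {E : Type*} [NormedAddCommGroup E] [NormedSpace ℝ E]

/-- The energy `½ ∫ₐᵇ G_γ(γ̇, γ̇) dt` of a curve. -/
def energy (G : E → E → E → ℝ) (a b : ℝ) (γ : ℝ → E) : ℝ :=
  (1 / 2) * ∫ t in a..b,
    G (γ t) (derivWithin γ (Icc a b) t) (derivWithin γ (Icc a b) t)

/-- `Γ s t` (`|s| < ε`, `t ∈ [a,b]`) is a `C²` variation in `M`, with fixed endpoints, of the curve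
`γ`. -/
structure IsVariation (M : Set E) (a b : ℝ) (γ : ℝ → E) (ε : ℝ) (Γ : ℝ → ℝ → E) : Prop where
  contDiffOn : ContDiffOn ℝ 2 (fun z : ℝ × ℝ => Γ z.1 z.2) (Ioo (-ε) ε ×ˢ Icc a b)
  mem : ∀ s ∈ Ioo (-ε) ε, ∀ t ∈ Icc a b, Γ s t ∈ M
  eq_zero : ∀ t ∈ Icc a b, Γ 0 t = γ t
  eq_left : ∀ s ∈ Ioo (-ε) ε, Γ s a = γ a
  eq_right : ∀ s ∈ Ioo (-ε) ε, Γ s b = γ b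

/-- `γ : [a,b] → M` is a geodesic of the submanifold `M` for the metric `G`: a `C²` curve which is
a critical point of the energy among the curves in `M` with the same endpoints. -/
structure IsGeodesic (M : Set E) (G : E → E → E → ℝ) (a b : ℝ) (γ : ℝ → E) : Prop where
  mem : ∀ t ∈ Icc a b, γ t ∈ M
  contDiffOn : ContDiffOn ℝ 2 γ (Icc a b)
  critical : ∀ ε > 0, ∀ Γ : ℝ → ℝ → E, IsVariation M a b γ ε Γ →
    HasDerivAt (fun s => energy G a b (Γ s)) 0 0

end Geodesics

/-! ### The first-order system -/

/-- The Hilbert matrix `H₂`. -/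
def hilbertMatrix : Matrix (Fin 2) (Fin 2) ℝ := !![1, 1 / 2; 1 / 2, 1 / 3]

def coefA (q p : L2) : ℝ := (1 / 2) * ∫ x in (0 : ℝ)..1, x * p (phiInv q x) ^ 2

def coefB (q p : L2) : ℝ :=
  (3 / 2) * ∫ x in (0 : ℝ)..1, (∫ y in (0 : ℝ)..x, p (phiInv q y)) ^ 2

def coefC (q p : L2) : ℝ := (1 / 4) * ∫ x in (0 : ℝ)..1, x ^ 2 * p (phiInv q x) ^ 2

/-- `-½ ∫ₓ¹ η p² dy + [1 φ] H₂⁻¹ [a; b + c]`. -/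
def momentumField (q p : L2) (x : ℝ) : ℝ :=
  -(1 / 2) * (∫ y in x..1, eta q y * p y ^ 2) +
    ![1, phi q x] ⬝ᵥ (hilbertMatrix⁻¹.mulVec ![coefA q p, coefB q p + coefC q p])

/-- `X` is the value at `(q, p)` of the right-hand side of the system. -/
def IsFieldAt (q p : L2) (X : L2 × L2) : Prop :=
  (X.1 =ᵐ[μI] fun x => eta q x * p x) ∧ (X.2 =ᵐ[μI] momentumField q p)

/-- The curve `(q, p)` in `T*Q` solves, on `[a,b]`, the system `q̇ = η p`,
`ṗ = -½ ∫ₓ¹ η p² dy + [1 φ] H₂⁻¹ [a; b + c]`, the derivatives being taken in `L²([0,1])`. -/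
def IsHamiltonianSolution (a b : ℝ) (q p : ℝ → L2) : Prop :=
  ∀ t ∈ Icc a b, (q t, p t) ∈ cotangentQ ∧ ∃ X : L2 × L2, IsFieldAt (q t) (p t) X ∧
    HasDerivWithinAt q X.1 (Icc a b) t ∧ HasDerivWithinAt p X.2 (Icc a b) t

end DiffGeodesics

end

noncomputable section

namespace DiffGeodesics

/-! ### Integration on the unit interval -/

/-! The coordinate `q = ∂ₓ log ∂ₓφ` makes the right-invariant metric explicit. One has `(X ∘ φ⁻¹)' =
(X'/φ') ∘ φ⁻¹`, and `X'/φ'` is the primitive of the variation `Z` of `q` induced by `X`. A second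
derivative gives `(Z/η) ∘ φ⁻¹`, and the substitution `y = φ(x)` turns the squared norm into `∫ Z²/η`
(`metricQ_logDerivTangent`). The coordinate is `w ↦ w / (1 + ∫₀ˣ w)` applied to `w = f''`, with
inverse `q ↦ q η(q)` (`logDerivMap`, `derivEta`). This inverse turns the nonlinear constraints of
`Q` into the two linear conditions that characterise second derivatives of `H₀²` functions
(`derivEta_mem`). So `Diff₀²` and `Q` are diffeomorphic and isometric, geodesics correspond
(`isGeodesic_iff_of_isometry`), and the same chart produces curves and variations inside `Q`.

On `Q` put `p = q̇/η`. Because `η` has derivative `h ↦ η ∫₀ˣ h`, an integration by parts shows that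
the first variation of the energy is `∫ ⟨-½ ∫ₓ¹ η p² - ṗ, δ⟩ dt` with `δ` tangent to `Q`
(`energy_first_variation`). Criticality therefore determines `ṗ` up to the orthogonal of `T_qQ`,
that is, up to a combination of `1` and `φ`. The two multipliers are fixed by the requirement that
the curve stay in `T*Q`: the pairings of `1` and `φ` with `η` and `ηφ` are the moments `∫ η φᵏ = ∫
xᵏ`, whence the Hilbert matrix, and differentiating the constraints gives the right-hand side `(a, b
+ c)` (`isTangent_field`).

The same multipliers are invisible to `dq ∧ dp` paired with tangent vectors, so the field represents
`dH` (`symplecticForm_field`). Uniqueness is nondegeneracy on the tangent spaces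
(`IsTangent.eq_zero_of_symplecticForm`), and these are identified with the tangent cone of `T*Q` by
`mem_tangentConeAt_iff`.

All calculus takes place in the Banach algebra `C([0,1])` acting on `L²` by multiplication: `η(q)`
is the exponential of a continuous linear map of `q`, hence smooth, and every identity between
integrals comes from one integration by parts, `primMul_toL`. -/

lemma intervalIntegral_eq_integral_μI (f : ℝ → ℝ) : ∫ x in (0 : ℝ)..1, f x = ∫ x, f x ∂μI := by
  rw [intervalIntegral.integral_of_le zero_le_one, integral_Icc_eq_integral_Ioc]

lemma intervalIntegrable_of_integrable {f : ℝ → ℝ} (hf : Integrable f μI) {a b : ℝ}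
    (ha : a ∈ Icc (0 : ℝ) 1) (hb : b ∈ Icc (0 : ℝ) 1) : IntervalIntegrable f volume a b := by
  rw [intervalIntegrable_iff]
  refine IntegrableOn.mono_set (t := Icc 0 1) hf ?_
  exact uIoc_subset_uIcc.trans (Icc_subset_Icc (le_inf ha.1 hb.1) (sup_le ha.2 hb.2))

lemma ae_μI_uIoc {P : ℝ → Prop} (h : ∀ᵐ x ∂μI, P x) {a b : ℝ}
    (ha : a ∈ Icc (0 : ℝ) 1) (hb : b ∈ Icc (0 : ℝ) 1) : ∀ᵐ x, x ∈ uIoc a b → P x := by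
  rw [ae_restrict_iff' measurableSet_Icc] at h
  filter_upwards [h] with x hx hx'
  exact hx (uIoc_subset_uIcc.trans (Icc_subset_Icc (le_inf ha.1 hb.1) (sup_le ha.2 hb.2)) hx')

lemma intervalIntegral_congr_μI {f g : ℝ → ℝ} (h : f =ᵐ[μI] g) {a b : ℝ}
    (ha : a ∈ Icc (0 : ℝ) 1) (hb : b ∈ Icc (0 : ℝ) 1) : ∫ x in a..b, f x = ∫ x in a..b, g x :=
  intervalIntegral.integral_congr_ae (ae_μI_uIoc h ha hb)

lemma zero_mem_I : (0 : ℝ) ∈ Icc (0 : ℝ) 1 := ⟨le_rfl, zero_le_one⟩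
lemma one_mem_I : (1 : ℝ) ∈ Icc (0 : ℝ) 1 := ⟨zero_le_one, le_rfl⟩

lemma integrable_mul_L2 (u v : L2) : Integrable (fun x => u x * v x) μI := by
  have := L2.integrable_inner (𝕜 := ℝ) v u
  simpa using this

lemma integrable_L2 (u : L2) : Integrable u μI :=
  (Lp.memLp u).integrable (by norm_num)

/-! ### Continuous functions on the unit interval acting on `L²` -/

/-- The Banach algebra `C([0,1])`. -/
abbrev CI : Type := C(Icc (0 : ℝ) 1, ℝ)

/-- Continuous extension of `g ∈ C([0,1])` to the line. -/
def extI (g : CI) : ℝ → ℝ := IccExtend zero_le_one g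

lemma continuous_extI (g : CI) : Continuous (extI g) := g.continuous.Icc_extend'

lemma extI_of_mem (g : CI) {x : ℝ} (hx : x ∈ Icc (0 : ℝ) 1) : extI g x = g ⟨x, hx⟩ :=
  IccExtend_of_mem _ _ hx

lemma norm_extI_le (g : CI) (x : ℝ) : ‖extI g x‖ ≤ ‖g‖ := g.norm_coe_le_norm _

lemma extI_add (g h : CI) (x : ℝ) : extI (g + h) x = extI g x + extI h x := rfl
lemma extI_sub (g h : CI) (x : ℝ) : extI (g - h) x = extI g x - extI h x := rfl
lemma extI_mul (g h : CI) (x : ℝ) : extI (g * h) x = extI g x * extI h x := rfl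
lemma extI_smul (c : ℝ) (g : CI) (x : ℝ) : extI (c • g) x = c * extI g x := rfl
lemma extI_one (x : ℝ) : extI 1 x = 1 := rfl

lemma memLp_extI_mul (g : CI) (u : L2) : MemLp (fun x => extI g x * u x) 2 μI := by
  refine MemLp.of_le_mul (c := ‖g‖) (Lp.memLp u) ?_ ?_
  · exact (continuous_extI g).aestronglyMeasurable.mul (Lp.memLp u).1
  · refine Eventually.of_forall fun x => ?_
    rw [norm_mul]
    exact mul_le_mul_of_nonneg_right (norm_extI_le g x) (norm_nonneg _)

/-- Multiplication of an element of `L²` by a continuous function. -/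
def mulL : CI →L[ℝ] L2 →L[ℝ] L2 :=
  LinearMap.mkContinuous₂
    (LinearMap.mk₂ ℝ (fun g u => (memLp_extI_mul g u).toLp _)
      (fun g h u => by
        rw [← MemLp.toLp_add, MemLp.toLp_eq_toLp_iff]
        exact Eventually.of_forall fun x => by simp [extI_add, add_mul])
      (fun c g u => by
        rw [← MemLp.toLp_const_smul, MemLp.toLp_eq_toLp_iff]
        exact Eventually.of_forall fun x => by simp [extI_smul, mul_assoc])
      (fun g u v => by
        rw [← MemLp.toLp_add, MemLp.toLp_eq_toLp_iff]
        filter_upwards [Lp.coeFn_add u v] with x hx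
        rw [hx, Pi.add_apply, Pi.add_apply, mul_add])
      (fun c g u => by
        rw [← MemLp.toLp_const_smul, MemLp.toLp_eq_toLp_iff]
        filter_upwards [Lp.coeFn_smul c u] with x hx
        rw [hx, Pi.smul_apply, Pi.smul_apply, smul_eq_mul, smul_eq_mul, mul_left_comm])) 1
    (fun g u => by
      rw [LinearMap.mk₂_apply, one_mul]
      refine Lp.norm_le_mul_norm_of_ae_le_mul ?_
      filter_upwards [MemLp.coeFn_toLp (memLp_extI_mul g u)] with x hx
      rw [hx, norm_mul]
      exact mul_le_mul_of_nonneg_right (norm_extI_le g x) (norm_nonneg _))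

lemma coeFn_mulL (g : CI) (u : L2) : mulL g u =ᵐ[μI] fun x => extI g x * u x :=
  MemLp.coeFn_toLp (memLp_extI_mul g u)

attribute [irreducible] mulL

lemma mulL_mulL (g h : CI) (u : L2) : mulL g (mulL h u) = mulL (g * h) u := by
  refine Lp.ext ?_
  filter_upwards [coeFn_mulL g (mulL h u), coeFn_mulL h u, coeFn_mulL (g * h) u] with x h1 h2 h3
  rw [h1, h2, h3, extI_mul, mul_assoc]

lemma one_mulL (u : L2) : mulL 1 u = u := by
  refine Lp.ext ?_
  filter_upwards [coeFn_mulL 1 u] with x h1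
  rw [h1, extI_one, one_mul]

/-- The constant function `1`. -/
def oneL : L2 := (memLp_const (1 : ℝ)).toLp _

lemma coeFn_oneL : oneL =ᵐ[μI] fun _ => (1 : ℝ) := MemLp.coeFn_toLp _

/-- The inclusion of `C([0,1])` in `L²([0,1])`. -/
def toL : CI →L[ℝ] L2 := mulL.flip oneL

lemma toL_eq (g : CI) : toL g = mulL g oneL := rfl

lemma coeFn_toL (g : CI) : toL g =ᵐ[μI] extI g := by
  filter_upwards [coeFn_mulL g oneL, coeFn_oneL] with x h1 h2
  rw [toL_eq, h1, h2, mul_one]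

lemma mulL_toL (g h : CI) : mulL g (toL h) = toL (g * h) := mulL_mulL g h oneL

lemma inner_eq_integral (u v : L2) : inner ℝ u v = ∫ x, u x * v x ∂μI := by
  rw [L2.inner_def]
  exact integral_congr_ae (Eventually.of_forall fun x => by simp [mul_comm])

lemma inner_mulL (g : CI) (u v : L2) : inner ℝ (mulL g u) v = inner ℝ u (mulL g v) := by
  rw [inner_eq_integral, inner_eq_integral]
  refine integral_congr_ae ?_
  filter_upwards [coeFn_mulL g u, coeFn_mulL g v] with x h1 h2
  rw [h1, h2]; ring

/-! ### Primitives -/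

lemma continuousOn_primitive_I {f : ℝ → ℝ} (hf : Integrable f μI) :
    ContinuousOn (fun x => ∫ y in (0 : ℝ)..x, f y) (Icc 0 1) := by
  have := intervalIntegral.continuousOn_primitive_interval (μ := volume) (f := f) (a := 0) (b := 1)
    (by rw [uIcc_of_le zero_le_one]; exact hf)
  rwa [uIcc_of_le zero_le_one] at this

/-- The primitive `∫₀ˣ f` of an integrable function. -/
def primC {f : ℝ → ℝ} (hf : Integrable f μI) : CI :=
  ⟨fun x => ∫ y in (0 : ℝ)..x, f y, (continuousOn_primitive_I hf).domRestrict⟩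

lemma primC_apply {f : ℝ → ℝ} (hf : Integrable f μI) (x : Icc (0 : ℝ) 1) :
    primC hf x = ∫ y in (0 : ℝ)..x, f y := rfl

/-- Cauchy–Schwarz for `|u|` and `|v|` on the whole interval. The bound is uniform in `x`, which
gives continuity of `primMul` into the sup norm. -/
lemma norm_intervalIntegral_mul_le (u v : L2) {x : ℝ} (hx : x ∈ Icc (0 : ℝ) 1) :
    ‖∫ y in (0 : ℝ)..x, u y * v y‖ ≤ ‖u‖ * ‖v‖ := by
  calc ‖∫ y in (0 : ℝ)..x, u y * v y‖ ≤ ∫ y in Ioc 0 x, ‖u y * v y‖ := by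
        rw [intervalIntegral.integral_of_le hx.1]
        exact norm_integral_le_integral_norm _
    _ ≤ ∫ y, ‖u y * v y‖ ∂μI := by
        refine setIntegral_mono_set (integrable_mul_L2 u v).norm
          (Eventually.of_forall fun _ => norm_nonneg _) ?_
        exact (Ioc_subset_Icc_self.trans (Icc_subset_Icc_right hx.2)).eventuallyLE
    _ = inner ℝ |u| |v| := by
        rw [inner_eq_integral]
        refine integral_congr_ae ?_
        filter_upwards [Lp.coeFn_abs u, Lp.coeFn_abs v] with y h1 h2
        rw [h1, h2, norm_mul, Real.norm_eq_abs, Real.norm_eq_abs]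
    _ ≤ ‖|u|‖ * ‖|v|‖ := real_inner_le_norm _ _
    _ = ‖u‖ * ‖v‖ := by rw [norm_abs_eq_norm, norm_abs_eq_norm]

/-- The bilinear map `(u, v) ↦ ∫₀ˣ u v`. -/
def primMul : L2 →L[ℝ] L2 →L[ℝ] CI :=
  LinearMap.mkContinuous₂
    (LinearMap.mk₂ ℝ (fun u v => primC (integrable_mul_L2 u v))
      (fun u u' v => by
        ext x
        rw [ContinuousMap.add_apply, primC_apply, primC_apply, primC_apply,
          ← intervalIntegral.integral_add
            (intervalIntegrable_of_integrable (integrable_mul_L2 u v) zero_mem_I x.2)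
            (intervalIntegrable_of_integrable (integrable_mul_L2 u' v) zero_mem_I x.2)]
        refine intervalIntegral_congr_μI ?_ zero_mem_I x.2
        filter_upwards [Lp.coeFn_add u u'] with y hy
        rw [hy, Pi.add_apply, add_mul])
      (fun c u v => by
        ext x
        rw [ContinuousMap.smul_apply, primC_apply, primC_apply, smul_eq_mul,
          ← intervalIntegral.integral_const_mul]
        refine intervalIntegral_congr_μI ?_ zero_mem_I x.2
        filter_upwards [Lp.coeFn_smul c u] with y hy
        rw [hy, Pi.smul_apply, smul_eq_mul, mul_assoc])
      (fun u v v' => by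
        ext x
        rw [ContinuousMap.add_apply, primC_apply, primC_apply, primC_apply,
          ← intervalIntegral.integral_add
            (intervalIntegrable_of_integrable (integrable_mul_L2 u v) zero_mem_I x.2)
            (intervalIntegrable_of_integrable (integrable_mul_L2 u v') zero_mem_I x.2)]
        refine intervalIntegral_congr_μI ?_ zero_mem_I x.2
        filter_upwards [Lp.coeFn_add v v'] with y hy
        rw [hy, Pi.add_apply, mul_add])
      (fun c u v => by
        ext x
        rw [ContinuousMap.smul_apply, primC_apply, primC_apply, smul_eq_mul,
          ← intervalIntegral.integral_const_mul]
        refine intervalIntegral_congr_μI ?_ zero_mem_I x.2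
        filter_upwards [Lp.coeFn_smul c v] with y hy
        rw [hy, Pi.smul_apply, smul_eq_mul, mul_left_comm])) 1
    (fun u v => by
      rw [LinearMap.mk₂_apply, one_mul]
      refine (ContinuousMap.norm_le _ (by positivity)).2 fun x => ?_
      exact norm_intervalIntegral_mul_le u v x.2)

lemma primMul_apply (u v : L2) (x : Icc (0 : ℝ) 1) :
    primMul u v x = ∫ y in (0 : ℝ)..x, u y * v y := rfl

attribute [irreducible] primMul

/-- The primitive `∫₀ˣ u`. -/
def prim : L2 →L[ℝ] CI := primMul oneL

lemma prim_apply (u : L2) (x : Icc (0 : ℝ) 1) : prim u x = ∫ y in (0 : ℝ)..x, u y := by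
  refine (primMul_apply oneL u x).trans (intervalIntegral_congr_μI ?_ zero_mem_I x.2)
  filter_upwards [coeFn_oneL] with y hy
  rw [hy, one_mul]

lemma extI_prim (u : L2) {x : ℝ} (hx : x ∈ Icc (0 : ℝ) 1) :
    extI (prim u) x = ∫ y in (0 : ℝ)..x, u y := by
  rw [extI_of_mem _ hx, prim_apply]

lemma extI_primMul (u v : L2) {x : ℝ} (hx : x ∈ Icc (0 : ℝ) 1) :
    extI (primMul u v) x = ∫ y in (0 : ℝ)..x, u y * v y := by
  rw [extI_of_mem _ hx, primMul_apply]

/-! ### Integration by parts -/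

lemma absCont_primitive {u : ℝ → ℝ} (hu : Integrable u μI) :
    AbsolutelyContinuousOnInterval (fun x => ∫ y in (0 : ℝ)..x, u y) 0 1 :=
  (intervalIntegrable_of_integrable hu zero_mem_I
    one_mem_I).absolutelyContinuousOnInterval_intervalIntegral left_mem_uIcc

lemma ae_hasDerivAt_primitive {u : ℝ → ℝ} (hu : Integrable u μI) :
    ∀ᵐ x ∂μI, HasDerivAt (fun x => ∫ y in (0 : ℝ)..x, u y) (u x) x := by
  rw [ae_restrict_iff' measurableSet_Icc]
  filter_upwards [(intervalIntegrable_of_integrable hu zero_mem_I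
    one_mem_I).ae_hasDerivAt_integral] with x hx hx'
  rw [uIcc_of_le zero_le_one] at hx
  exact hx hx' 0 zero_mem_I

/-- Integration by parts for absolutely continuous functions. Both primitives start at `0`, so only
the boundary term at `z` survives. -/
lemma integral_primitive_mul {u v : ℝ → ℝ} (hu : Integrable u μI) (hv : Integrable v μI)
    {z : ℝ} (hz : z ∈ Icc (0 : ℝ) 1) :
    ∫ x in (0 : ℝ)..z, (∫ y in (0 : ℝ)..x, u y) * v x =
      (∫ x in (0 : ℝ)..z, u x) * (∫ x in (0 : ℝ)..z, v x) -
        ∫ x in (0 : ℝ)..z, u x * ∫ y in (0 : ℝ)..x, v y := by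
  have hsub : uIcc 0 z ⊆ uIcc (0 : ℝ) 1 := by
    rw [uIcc_of_le hz.1, uIcc_of_le zero_le_one]
    exact Icc_subset_Icc_right hz.2
  have h := ((absCont_primitive hu).mono hsub).integral_mul_deriv_eq_deriv_mul
    ((absCont_primitive hv).mono hsub)
  have h1 : ∫ x in (0 : ℝ)..z, (∫ y in (0 : ℝ)..x, u y) *
      deriv (fun x => ∫ y in (0 : ℝ)..x, v y) x =
      ∫ x in (0 : ℝ)..z, (∫ y in (0 : ℝ)..x, u y) * v x := by
    refine intervalIntegral_congr_μI ?_ zero_mem_I hz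
    filter_upwards [ae_hasDerivAt_primitive hv] with x hx
    rw [hx.deriv]
  have h2 : ∫ x in (0 : ℝ)..z, deriv (fun x => ∫ y in (0 : ℝ)..x, u y) x *
      (∫ y in (0 : ℝ)..x, v y) =
      ∫ x in (0 : ℝ)..z, u x * ∫ y in (0 : ℝ)..x, v y := by
    refine intervalIntegral_congr_μI ?_ zero_mem_I hz
    filter_upwards [ae_hasDerivAt_primitive hu] with x hx
    rw [hx.deriv]
  rw [h1, h2] at h
  rw [h]
  simp

/-- The right end of the unit interval. -/
def oneI : Icc (0 : ℝ) 1 := ⟨1, one_mem_I⟩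

lemma primMul_oneI (u v : L2) : primMul u v oneI = inner ℝ u v := by
  rw [primMul_apply, inner_eq_integral, ← intervalIntegral_eq_integral_μI]
  rfl

lemma prim_oneI (u : L2) : prim u oneI = inner ℝ oneL u := primMul_oneI _ _

lemma primMul_mulL (g : CI) (u v : L2) : primMul (mulL g u) v = primMul u (mulL g v) := by
  ext x
  rw [primMul_apply, primMul_apply]
  refine intervalIntegral_congr_μI ?_ zero_mem_I x.2
  filter_upwards [coeFn_mulL g u, coeFn_mulL g v] with y h1 h2
  rw [h1, h2]; ring

lemma primMul_comm (u v : L2) : primMul u v = primMul v u := by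
  ext x
  simp only [primMul_apply, mul_comm]

/-- Integration by parts of the primitive of `uv` against `h`, as an identity in `C([0,1])`. The
Leibniz rule and all the moment computations below are instances of it. -/
lemma primMul_toL (u v : L2) (h : L2) :
    primMul (toL (primMul u v)) h = primMul u v * prim h - primMul (mulL (prim h) u) v := by
  ext x
  have key := integral_primitive_mul (integrable_mul_L2 u v) (integrable_L2 h) x.2
  rw [ContinuousMap.sub_apply, ContinuousMap.mul_apply, prim_apply, primMul_apply u v,
    primMul_apply, primMul_apply]
  have h1 : ∫ y in (0 : ℝ)..x, toL (primMul u v) y * h y =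
      ∫ y in (0 : ℝ)..x, (∫ w in (0 : ℝ)..y, u w * v w) * h y := by
    refine intervalIntegral_congr_μI ?_ zero_mem_I x.2
    filter_upwards [coeFn_toL (primMul u v), ae_restrict_mem measurableSet_Icc] with y hy hy'
    rw [hy, extI_primMul _ _ hy']
  have h2 : ∫ y in (0 : ℝ)..x, mulL (prim h) u y * v y =
      ∫ y in (0 : ℝ)..x, (u y * v y) * (∫ w in (0 : ℝ)..y, h w) := by
    refine intervalIntegral_congr_μI ?_ zero_mem_I x.2
    filter_upwards [coeFn_mulL (prim h) u, ae_restrict_mem measurableSet_Icc] with y hy hy'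
    rw [hy, extI_prim _ hy']; ring
  rw [h1, h2, key]

lemma inner_toL_primMul (u v h : L2) :
    inner ℝ (toL (primMul u v)) h =
      inner ℝ u v * inner ℝ oneL h - inner ℝ (mulL (prim h) u) v := by
  rw [← primMul_oneI, primMul_toL, ContinuousMap.sub_apply, ContinuousMap.mul_apply, primMul_oneI,
    primMul_oneI, prim_oneI]

/-- Leibniz rule for primitives. -/
lemma prim_mul_prim (u v : L2) :
    prim u * prim v = prim (mulL (prim u) v) + prim (mulL (prim v) u) := by
  have h := primMul_toL oneL u v
  rw [show primMul oneL u = prim u from rfl, toL_eq, primMul_mulL,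
    show primMul oneL (mulL (prim u) v) = prim (mulL (prim u) v) from rfl, primMul_mulL,
    show primMul oneL (mulL (prim v) u) = prim (mulL (prim v) u) from rfl] at h
  rw [h]; abel

/-! ### The functions `η(q)` and `φ(q)` as elements of `C([0,1])` -/

/-- Evaluation at a point is a continuous algebra homomorphism, so it commutes with the exponential
series. -/
lemma exp_apply_CI (g : CI) (x : Icc (0 : ℝ) 1) : NormedSpace.exp g x = Real.exp (g x) := by
  rw [Real.exp_eq_exp_ℝ]
  exact NormedSpace.map_exp (ContinuousMap.evalAlgHom ℝ ℝ x) (continuous_eval_const x) g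

/-- `η(q)` as a continuous function. -/
def etaC (q : L2) : CI := NormedSpace.exp (prim q)

lemma etaC_apply (q : L2) (x : Icc (0 : ℝ) 1) : etaC q x = eta q x := by
  rw [etaC, exp_apply_CI, prim_apply, eta]

lemma extI_etaC (q : L2) {x : ℝ} (hx : x ∈ Icc (0 : ℝ) 1) : extI (etaC q) x = eta q x := by
  rw [extI_of_mem _ hx, etaC_apply]

lemma eta_pos (q : L2) (x : ℝ) : 0 < eta q x := Real.exp_pos _

lemma etaC_mul_etaC_neg (q : L2) : etaC q * etaC (-q) = 1 := by
  ext x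
  rw [ContinuousMap.mul_apply, etaC, etaC, exp_apply_CI, exp_apply_CI, ← Real.exp_add, map_neg]
  simp

lemma etaC_neg_mul_etaC (q : L2) : etaC (-q) * etaC q = 1 := by
  rw [mul_comm, etaC_mul_etaC_neg]

lemma extI_etaC_neg (q : L2) {x : ℝ} (hx : x ∈ Icc (0 : ℝ) 1) :
    extI (etaC (-q)) x = (eta q x)⁻¹ := by
  have h : extI (etaC q * etaC (-q)) x = 1 := by rw [etaC_mul_etaC_neg, extI_one]
  rw [extI_mul, extI_etaC q hx] at h
  exact eq_inv_of_mul_eq_one_right h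

/-- `φ(q)` as a continuous function. -/
def phiC (q : L2) : CI := prim (toL (etaC q))

lemma phiC_apply (q : L2) (x : Icc (0 : ℝ) 1) : phiC q x = phi q x := by
  rw [phiC, prim_apply, phi]
  refine intervalIntegral_congr_μI ?_ zero_mem_I x.2
  filter_upwards [coeFn_toL (etaC q), ae_restrict_mem measurableSet_Icc] with y hy hy'
  rw [hy, extI_etaC q hy']

lemma extI_phiC (q : L2) {x : ℝ} (hx : x ∈ Icc (0 : ℝ) 1) : extI (phiC q) x = phi q x := by
  rw [extI_of_mem _ hx, phiC_apply]

lemma mem_Q_iff {q : L2} :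
    q ∈ Q ↔ inner ℝ oneL q = 0 ∧ inner ℝ oneL (toL (etaC q)) = 1 := by
  rw [← prim_oneI, ← prim_oneI, prim_apply]
  change _ ↔ _ ∧ phiC q oneI = 1
  rw [phiC_apply]
  rfl

lemma phi_one {q : L2} (hq : q ∈ Q) : phi q 1 = 1 := hq.2

lemma phiC_oneI {q : L2} (hq : q ∈ Q) : phiC q oneI = 1 := by
  rw [phiC_apply]; exact hq.2

lemma mem_cotangentQ_iff {q p : L2} :
    (q, p) ∈ cotangentQ ↔ q ∈ Q ∧ inner ℝ (toL (etaC q)) p = 0 ∧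
      inner ℝ (toL (etaC q * phiC q)) p = 0 := by
  have h1 : ∫ x in (0 : ℝ)..1, eta q x * p x = inner ℝ (toL (etaC q)) p := by
    rw [inner_eq_integral, ← intervalIntegral_eq_integral_μI]
    refine intervalIntegral_congr_μI ?_ zero_mem_I one_mem_I
    filter_upwards [coeFn_toL (etaC q), ae_restrict_mem measurableSet_Icc] with y hy hy'
    rw [hy, extI_etaC q hy']
  have h2 : ∫ x in (0 : ℝ)..1, eta q x * p x * phi q x = inner ℝ (toL (etaC q * phiC q)) p := by
    rw [inner_eq_integral, ← intervalIntegral_eq_integral_μI]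
    refine intervalIntegral_congr_μI ?_ zero_mem_I one_mem_I
    filter_upwards [coeFn_toL (etaC q * phiC q), ae_restrict_mem measurableSet_Icc] with y hy hy'
    rw [hy, extI_mul, extI_etaC q hy', extI_phiC q hy']; ring
  rw [← h1, ← h2]
  rfl

/-- Uses `1/η(q) = η(-q)`. -/
lemma metricQ_eq (q X Y : L2) : metricQ q X Y = inner ℝ (mulL (etaC (-q)) X) Y := by
  rw [inner_eq_integral, ← intervalIntegral_eq_integral_μI, metricQ]
  refine intervalIntegral_congr_μI ?_ zero_mem_I one_mem_I
  filter_upwards [coeFn_mulL (etaC (-q)) X, ae_restrict_mem measurableSet_Icc] with y hy hy'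
  rw [hy, extI_etaC_neg q hy', div_eq_inv_mul, mul_assoc]

lemma hamiltonian_eq (z : L2 × L2) :
    hamiltonian z = (1 / 2) * inner ℝ (mulL (etaC z.1) z.2) z.2 := by
  rw [inner_eq_integral, ← intervalIntegral_eq_integral_μI, hamiltonian]
  congr 1
  refine intervalIntegral_congr_μI ?_ zero_mem_I one_mem_I
  filter_upwards [coeFn_mulL (etaC z.1) z.2, ae_restrict_mem measurableSet_Icc] with y hy hy'
  rw [hy, extI_etaC _ hy']; ring

/-! ### Change of variables by `φ(q)` -/

lemma hasDerivWithinAt_phi (q : L2) {x : ℝ} (hx : x ∈ Icc (0 : ℝ) 1) :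
    HasDerivWithinAt (phi q) (eta q x) (Icc 0 1) x := by
  have h : HasDerivAt (fun z => ∫ y in (0 : ℝ)..z, extI (etaC q) y) (extI (etaC q) x) x :=
    (continuous_extI _).integral_hasStrictDerivAt 0 x |>.hasDerivAt
  rw [extI_etaC q hx] at h
  have hc : ∀ z ∈ Icc (0 : ℝ) 1, phi q z = ∫ y in (0 : ℝ)..z, extI (etaC q) y := by
    intro z hz
    refine intervalIntegral_congr_μI ?_ zero_mem_I hz
    filter_upwards [ae_restrict_mem measurableSet_Icc] with y hy
    rw [extI_etaC q hy]
  exact h.hasDerivWithinAt.congr hc (hc x hx)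

lemma continuousOn_phi (q : L2) : ContinuousOn (phi q) (Icc 0 1) :=
  fun _ hx => (hasDerivWithinAt_phi q hx).continuousWithinAt

lemma strictMonoOn_phi (q : L2) : StrictMonoOn (phi q) (Icc 0 1) := by
  refine strictMonoOn_of_deriv_pos (convex_Icc 0 1) (continuousOn_phi q) fun x hx => ?_
  rw [interior_Icc] at hx
  rw [((hasDerivWithinAt_phi q (Ioo_subset_Icc_self hx)).hasDerivAt
    (Icc_mem_nhds hx.1 hx.2)).deriv]
  exact eta_pos q x

lemma phi_zero (q : L2) : phi q 0 = 0 := by simp [phi]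

lemma phiInv_phi (q : L2) {x : ℝ} (hx : x ∈ Icc (0 : ℝ) 1) : phiInv q (phi q x) = x :=
  (strictMonoOn_phi q).injOn.leftInvOn_invFunOn hx

lemma phi_image_Icc (q : L2) {z : ℝ} (hz : z ∈ Icc (0 : ℝ) 1) :
    phi q '' Icc 0 z = Icc 0 (phi q z) := by
  have hsub : Icc 0 z ⊆ Icc (0 : ℝ) 1 := Icc_subset_Icc_right hz.2
  refine Subset.antisymm ?_ ?_
  · rintro _ ⟨y, hy, rfl⟩
    refine ⟨?_, (strictMonoOn_phi q).monotoneOn (hsub hy) hz hy.2⟩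
    rw [← phi_zero q]
    exact (strictMonoOn_phi q).monotoneOn zero_mem_I (hsub hy) hy.1
  · have := intermediate_value_Icc hz.1 ((continuousOn_phi q).mono hsub)
    rwa [phi_zero] at this

/-- Change of variables for the injective map `φ(q)`, whose derivative `η(q)` is positive. -/
lemma integral_phi (q : L2) {z : ℝ} (hz : z ∈ Icc (0 : ℝ) 1) (g : ℝ → ℝ) :
    ∫ y in (0 : ℝ)..phi q z, g y = ∫ x in (0 : ℝ)..z, eta q x * g (phi q x) := by
  have hsub : Icc 0 z ⊆ Icc (0 : ℝ) 1 := Icc_subset_Icc_right hz.2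
  have h0 : 0 ≤ phi q z := by
    rw [← phi_zero q]
    exact (strictMonoOn_phi q).monotoneOn zero_mem_I hz hz.1
  rw [intervalIntegral.integral_of_le h0, intervalIntegral.integral_of_le hz.1,
    ← integral_Icc_eq_integral_Ioc, ← integral_Icc_eq_integral_Ioc, ← phi_image_Icc q hz,
    integral_image_eq_integral_abs_deriv_smul measurableSet_Icc
      (fun x hx => (hasDerivWithinAt_phi q (hsub hx)).mono hsub)
      ((strictMonoOn_phi q).injOn.mono hsub)]
  refine setIntegral_congr_fun measurableSet_Icc fun x _ => ?_
  simp only [abs_of_pos (eta_pos q x), smul_eq_mul]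

lemma integral_phi_one {q : L2} (hq : q ∈ Q) (g : ℝ → ℝ) :
    ∫ y in (0 : ℝ)..1, g y = ∫ x in (0 : ℝ)..1, eta q x * g (phi q x) := by
  have := integral_phi q one_mem_I g
  rwa [phi_one hq] at this

/-! ### The vector field -/

/-- `∫₀ˣ η p`. -/
def primMom (q p : L2) : CI := prim (mulL (etaC q) p)

/-- `∫ₓ¹ η p²`. -/
def tailC (q p : L2) : CI :=
  inner ℝ (mulL (etaC q) p) p • (1 : CI) - primMul (mulL (etaC q) p) p

/-- The coefficients `a`, `b`, `c` after the substitution `x = φ(q)(y)`. No inverse of `φ` remains,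
so they visibly depend continuously on `(q, p)`. -/
def coefA' (q p : L2) : ℝ := (1 / 2) * inner ℝ (mulL (etaC q * phiC q) p) p

def coefB' (q p : L2) : ℝ :=
  (3 / 2) * inner ℝ (mulL (etaC q) (toL (primMom q p))) (toL (primMom q p))

def coefC' (q p : L2) : ℝ := (1 / 4) * inner ℝ (mulL (etaC q * phiC q * phiC q) p) p

/-- The combination of `1` and `φ(q)` whose pairings with `η(q)` and `η(q) φ(q)` are `s` and `t`,
when `q ∈ Q`. -/
def lagrC (q : L2) (s t : ℝ) : CI := (4 * s - 6 * t) • (1 : CI) + (-6 * s + 12 * t) • phiC q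

/-- The second component of the vector field, as a continuous function. -/
def momentumC (q p : L2) : CI :=
  (-(1 / 2 : ℝ)) • tailC q p + lagrC q (coefA' q p) (coefB' q p + coefC' q p)

lemma coefA_eq {q : L2} (hq : q ∈ Q) (p : L2) : coefA q p = coefA' q p := by
  rw [coefA, coefA', integral_phi_one hq, inner_eq_integral, ← intervalIntegral_eq_integral_μI]
  congr 1
  refine intervalIntegral_congr_μI ?_ zero_mem_I one_mem_I
  filter_upwards [coeFn_mulL (etaC q * phiC q) p, ae_restrict_mem measurableSet_Icc] with y hy hy'
  rw [hy, phiInv_phi q hy', extI_mul, extI_etaC q hy', extI_phiC q hy']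
  ring

lemma coefC_eq {q : L2} (hq : q ∈ Q) (p : L2) : coefC q p = coefC' q p := by
  rw [coefC, coefC', integral_phi_one hq, inner_eq_integral, ← intervalIntegral_eq_integral_μI]
  congr 1
  refine intervalIntegral_congr_μI ?_ zero_mem_I one_mem_I
  filter_upwards [coeFn_mulL (etaC q * phiC q * phiC q) p,
    ae_restrict_mem measurableSet_Icc] with y hy hy'
  rw [hy, phiInv_phi q hy', extI_mul, extI_mul, extI_etaC q hy', extI_phiC q hy']
  ring

lemma integral_phiInv {q : L2} (p : L2) {z : ℝ} (hz : z ∈ Icc (0 : ℝ) 1) :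
    ∫ y in (0 : ℝ)..phi q z, p (phiInv q y) = extI (primMom q p) z := by
  rw [integral_phi q hz, primMom, extI_prim _ hz]
  refine intervalIntegral_congr_μI ?_ zero_mem_I hz
  filter_upwards [coeFn_mulL (etaC q) p, ae_restrict_mem measurableSet_Icc] with y hy hy'
  rw [hy, phiInv_phi q hy', extI_etaC q hy']

lemma coefB_eq {q : L2} (hq : q ∈ Q) (p : L2) : coefB q p = coefB' q p := by
  rw [coefB, coefB', integral_phi_one hq, inner_eq_integral, ← intervalIntegral_eq_integral_μI]
  congr 1
  refine intervalIntegral_congr_μI ?_ zero_mem_I one_mem_I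
  filter_upwards [coeFn_mulL (etaC q) (toL (primMom q p)), coeFn_toL (primMom q p),
    ae_restrict_mem measurableSet_Icc] with y hy hz hy'
  rw [hy, hz, integral_phiInv p hy', extI_etaC q hy']
  ring

lemma extI_tailC (q p : L2) {x : ℝ} (hx : x ∈ Icc (0 : ℝ) 1) :
    extI (tailC q p) x = ∫ y in x..1, eta q y * p y ^ 2 := by
  have hi := integrable_mul_L2 (mulL (etaC q) p) p
  rw [tailC, extI_sub, extI_smul, extI_one, mul_one, extI_primMul _ _ hx, inner_eq_integral,
    ← intervalIntegral_eq_integral_μI, intervalIntegral.integral_interval_sub_left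
      (intervalIntegrable_of_integrable hi zero_mem_I one_mem_I)
      (intervalIntegrable_of_integrable hi zero_mem_I hx)]
  refine intervalIntegral_congr_μI ?_ hx one_mem_I
  filter_upwards [coeFn_mulL (etaC q) p, ae_restrict_mem measurableSet_Icc] with y hy hy'
  rw [hy, extI_etaC q hy']
  ring

lemma hilbertMatrix_inv : hilbertMatrix⁻¹ = !![4, -6; -6, 12] := by
  refine Matrix.inv_eq_right_inv ?_
  rw [hilbertMatrix, Matrix.mul_fin_two, Matrix.one_fin_two]
  norm_num

lemma momentumField_eq {q : L2} (hq : q ∈ Q) (p : L2) {x : ℝ} (hx : x ∈ Icc (0 : ℝ) 1) :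
    momentumField q p x = extI (momentumC q p) x := by
  rw [momentumField, hilbertMatrix_inv, coefA_eq hq, coefB_eq hq, coefC_eq hq, momentumC,
    lagrC, extI_add, extI_add, extI_smul, extI_smul, extI_smul, extI_one, extI_tailC q p hx,
    extI_phiC q hx]
  simp [Matrix.mulVec, dotProduct, Fin.sum_univ_two]
  ring

attribute [irreducible] etaC tailC lagrC momentumC coefA' coefB' coefC'

/-- The vector field of the system. -/
def field (q p : L2) : L2 × L2 := (mulL (etaC q) p, toL (momentumC q p))

/-- The right-hand side is prescribed almost everywhere, so it is a single element of `L² × L²`,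
given by the expressions without `φ⁻¹`. -/
lemma isFieldAt_iff {q : L2} (hq : q ∈ Q) (p : L2) (X : L2 × L2) :
    IsFieldAt q p X ↔ X = field q p := by
  have h1 : (fun x => eta q x * p x) =ᵐ[μI] mulL (etaC q) p := by
    filter_upwards [coeFn_mulL (etaC q) p, ae_restrict_mem measurableSet_Icc] with y hy hy'
    rw [hy, extI_etaC q hy']
  have h2 : momentumField q p =ᵐ[μI] toL (momentumC q p) := by
    filter_upwards [coeFn_toL (momentumC q p), ae_restrict_mem measurableSet_Icc] with y hy hy'
    rw [hy, momentumField_eq hq p hy']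
  constructor
  · rintro ⟨hX1, hX2⟩
    exact Prod.ext (Lp.ext (hX1.trans h1)) (Lp.ext (hX2.trans h2))
  · rintro rfl
    exact ⟨h1.symm, h2.symm⟩

/-! ### Derivatives of `η` and `φ` -/

lemma contDiff_etaC {n : WithTop ℕ∞} : ContDiff ℝ n etaC := by
  have h : ContDiff ℝ n (NormedSpace.exp : CI → CI) :=
    AnalyticOnNhd.contDiff fun x _ => NormedSpace.exp_analytic x
  rw [show etaC = fun q => NormedSpace.exp (prim q) from funext fun q => by rw [etaC]]
  exact h.comp prim.contDiff

/-- `C([0,1])` is commutative, so the derivative of `exp` at `g` is multiplication by `exp g`. -/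
lemma hasFDerivAt_etaC (q : L2) :
    HasFDerivAt etaC ((ContinuousLinearMap.mul ℝ CI (etaC q)).comp prim) q := by
  have h : HasFDerivAt (NormedSpace.exp : CI → CI) _ (prim q) := hasFDerivAt_exp (𝕂 := ℝ)
  have h' := h.comp q prim.hasFDerivAt
  rw [show NormedSpace.exp ∘ prim = etaC from funext fun q => by rw [etaC]; rfl] at h'
  refine h'.congr_fderiv ?_
  ext v : 1
  rw [etaC]
  rfl

lemma contDiff_phiC {n : WithTop ℕ∞} : ContDiff ℝ n phiC :=
  prim.contDiff.comp (toL.contDiff.comp contDiff_etaC)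

lemma hasFDerivAt_phiC (q : L2) : HasFDerivAt phiC
    ((prim.comp toL).comp ((ContinuousLinearMap.mul ℝ CI (etaC q)).comp prim)) q :=
  (prim.comp toL).hasFDerivAt.comp q (hasFDerivAt_etaC q)

lemma continuous_field : Continuous fun z : L2 × L2 => field z.1 z.2 := by
  have h1 : Continuous etaC := contDiff_etaC.continuous (n := 0)
  have h2 : Continuous phiC := contDiff_phiC.continuous (n := 0)
  unfold field momentumC tailC lagrC coefA' coefB' coefC' primMom
  fun_prop

/-! ### Inner products of elements of `C([0,1])` -/

lemma inner_toL_toL (g h : CI) : inner ℝ (toL g) (toL h) = inner ℝ oneL (toL (g * h)) := by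
  rw [toL_eq g, inner_mulL, mulL_toL]

lemma inner_toL (g : CI) (u : L2) : inner ℝ (toL g) u = inner ℝ oneL (mulL g u) := by
  rw [toL_eq g, inner_mulL]

lemma toL_one : toL 1 = oneL := one_mulL _

/-- The operator `u ↦ ∫₀ˣ u` is antisymmetric up to a rank-one boundary term. In particular it is
antisymmetric on functions of mean zero. -/
lemma inner_toL_prim (u v : L2) : inner ℝ (toL (prim u)) v =
    inner ℝ oneL u * inner ℝ oneL v - inner ℝ u (toL (prim v)) := by
  have h := inner_toL_primMul oneL u v
  rw [show primMul oneL u = prim u from rfl] at h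
  rw [h, ← toL_eq, real_inner_comm u (toL (prim v))]

lemma inner_one_etaC {q : L2} (hq : q ∈ Q) : inner ℝ oneL (toL (etaC q)) = 1 := (mem_Q_iff.1 hq).2

/-- Leibniz: `φ' = η`, hence `(φ²)' = 2 η φ`. -/
lemma prim_etaC_mul_phiC (q : L2) :
    prim (toL (etaC q * phiC q)) = (1 / 2 : ℝ) • (phiC q * phiC q) := by
  have h := prim_mul_prim (toL (etaC q)) (toL (etaC q))
  rw [mulL_toL, mul_comm] at h
  change phiC q * phiC q = _ at h
  rw [h, ← two_smul ℝ, smul_smul, mul_comm (etaC q)]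
  norm_num [phiC]

lemma inner_one_etaC_phiC {q : L2} (hq : q ∈ Q) :
    inner ℝ oneL (toL (etaC q * phiC q)) = 1 / 2 := by
  rw [← prim_oneI, prim_etaC_mul_phiC, ContinuousMap.smul_apply, ContinuousMap.mul_apply,
    phiC_oneI hq]
  norm_num

/-- Since `η` has primitive `φ` and `ηφ` has primitive `φ²/2`, integration by parts gives `I = 1/2 -
I/2`. The moments `1`, `1/2`, `1/3` are the entries of `H₂`. -/
lemma inner_one_etaC_phiC_phiC {q : L2} (hq : q ∈ Q) :
    inner ℝ oneL (toL (etaC q * phiC q * phiC q)) = 1 / 3 := by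
  have h := inner_toL_prim (toL (etaC q)) (toL (etaC q * phiC q))
  rw [inner_one_etaC hq, inner_one_etaC_phiC hq, prim_etaC_mul_phiC, map_smul, inner_smul_right,
    inner_toL_toL, inner_toL_toL] at h
  change inner ℝ oneL (toL (phiC q * (etaC q * phiC q))) = _ at h
  rw [show phiC q * (etaC q * phiC q) = etaC q * phiC q * phiC q by ring,
    show etaC q * (phiC q * phiC q) = etaC q * phiC q * phiC q by ring] at h
  linarith

lemma inner_etaC_lagrC {q : L2} (hq : q ∈ Q) (s t : ℝ) :
    inner ℝ (toL (etaC q)) (toL (lagrC q s t)) = s := by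
  rw [lagrC, map_add, map_smul, map_smul, inner_add_right, inner_smul_right, inner_smul_right,
    inner_toL_toL, inner_toL_toL, mul_one, inner_one_etaC hq, inner_one_etaC_phiC hq]
  ring

lemma inner_etaC_phiC_lagrC {q : L2} (hq : q ∈ Q) (s t : ℝ) :
    inner ℝ (toL (etaC q * phiC q)) (toL (lagrC q s t)) = t := by
  rw [lagrC, map_add, map_smul, map_smul, inner_add_right, inner_smul_right, inner_smul_right,
    inner_toL_toL, inner_toL_toL, mul_one, inner_one_etaC_phiC hq, inner_one_etaC_phiC_phiC hq]
  ring

/-- Exchange of the order of integration: `∫ η (∫ₓ¹ η p²) = ∫ φ η p²`, because `φ` is the primitive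
of `η`. -/
lemma inner_etaC_tailC {q : L2} (hq : q ∈ Q) (p : L2) :
    inner ℝ (toL (etaC q)) (toL (tailC q p)) = 2 * coefA' q p := by
  rw [tailC, map_sub, map_smul, inner_sub_right, inner_smul_right, inner_toL_toL, mul_one,
    inner_one_etaC hq,
    real_inner_comm (toL (primMul (mulL (etaC q) p) p)) (toL (etaC q)), inner_toL_primMul, inner_one_etaC hq, mulL_mulL, coefA']
  change _ - (_ - inner ℝ (mulL (phiC q * etaC q) p) p) = _
  rw [mul_comm (phiC q)]
  ring

/-- As for the weight `η`, but the primitive of `ηφ` is `φ²/2`. -/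
lemma inner_etaC_phiC_tailC {q : L2} (hq : q ∈ Q) (p : L2) :
    inner ℝ (toL (etaC q * phiC q)) (toL (tailC q p)) = 2 * coefC' q p := by
  rw [tailC, map_sub, map_smul, inner_sub_right, inner_smul_right, inner_toL_toL, mul_one,
    inner_one_etaC_phiC hq,
    real_inner_comm (toL (primMul (mulL (etaC q) p) p)) (toL (etaC q * phiC q)),
    inner_toL_primMul, inner_one_etaC_phiC hq, mulL_mulL,
    coefC', prim_etaC_mul_phiC, smul_mul_assoc, map_smul, smul_apply,
    inner_smul_left, show phiC q * phiC q * etaC q = etaC q * phiC q * phiC q by ring]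
  simp only [conj_trivial]
  ring

/-! ### Positivity -/

lemma etaC_add (u v : L2) : etaC (u + v) = etaC u * etaC v := by
  ext x
  rw [ContinuousMap.mul_apply, etaC, etaC, etaC, exp_apply_CI, exp_apply_CI, exp_apply_CI,
    ← Real.exp_add, map_add, ContinuousMap.add_apply]

/-- `η(q)` is the square of the invertible function `η(q/2)`, so the quadratic form is `‖η(q/2)
r‖²`. -/
lemma eq_zero_of_inner_etaC {q r : L2} (h : inner ℝ (mulL (etaC q) r) r = 0) : r = 0 := by
  have h1 : etaC q = etaC ((1 / 2 : ℝ) • q) * etaC ((1 / 2 : ℝ) • q) := by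
    rw [← etaC_add, ← add_smul]; norm_num
  rw [h1, ← mulL_mulL, inner_mulL, inner_self_eq_zero] at h
  rw [← one_mulL r, ← etaC_neg_mul_etaC ((1 / 2 : ℝ) • q), ← mulL_mulL, h, map_zero]

/-! ### Tangent vectors -/

/-- `h` is tangent to `Q` at `q`. -/
structure IsTangentQ (q h : L2) : Prop where
  inner_one : inner ℝ oneL h = 0
  inner_phi : inner ℝ (toL (phiC q)) h = 0

/-- `(h, k)` is tangent to `T*Q` at `(q, p)`. -/
structure IsTangent (q p : L2) (V : L2 × L2) : Prop where
  fst : IsTangentQ q V.1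
  eta : inner ℝ (toL (etaC q * prim V.1)) p + inner ℝ (toL (etaC q)) V.2 = 0
  eta_phi : inner ℝ (toL (etaC q * prim V.1 * phiC q +
    etaC q * prim (toL (etaC q * prim V.1)))) p + inner ℝ (toL (etaC q * phiC q)) V.2 = 0

lemma IsTangent.sub {q p : L2} {V W : L2 × L2} (hV : IsTangent q p V) (hW : IsTangent q p W) :
    IsTangent q p (V - W) := by
  refine ⟨⟨?_, ?_⟩, ?_, ?_⟩
  · rw [Prod.fst_sub, inner_sub_right, hV.1.1, hW.1.1, sub_zero]
  · rw [Prod.fst_sub, inner_sub_right, hV.1.2, hW.1.2, sub_zero]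
  · have h1 := hV.2
    have h2 := hW.2
    simp only [Prod.fst_sub, Prod.snd_sub, map_sub, mul_sub, inner_sub_left, inner_sub_right]
    linarith
  · have h1 := hV.3
    have h2 := hW.3
    simp only [map_add, inner_add_left] at h1 h2
    simp only [Prod.fst_sub, Prod.snd_sub, map_sub, map_add, mul_sub, sub_mul, inner_sub_left,
      inner_sub_right, inner_add_left]
    linarith

/-- The identification of covectors with tangent vectors by the metric: `r` corresponds to `X = η
r`. -/
lemma isTangentQ_mulL_etaC {q r : L2} (h1 : inner ℝ (toL (etaC q)) r = 0)
    (h2 : inner ℝ (toL (etaC q * phiC q)) r = 0) : IsTangentQ q (mulL (etaC q) r) := by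
  refine ⟨?_, ?_⟩
  · rw [← inner_toL, h1]
  · rw [← inner_mulL, mulL_toL, h2]

/-- This is where `a` and `b + c` come from. Let `A = η p` and `I = ∫ (∫₀ˣ A)² η`. In the first
linearised constraint the part due to `q̇` vanishes, and the tail term contributes `-a`. In the
second, the part due to `q̇` is `-½ I - I = -b`, and the tail term contributes `-c`. The multipliers
compensate exactly these amounts. -/
lemma isTangent_field {q p : L2} (h : (q, p) ∈ cotangentQ) : IsTangent q p (field q p) := by
  obtain ⟨hq, h1, h2⟩ := mem_cotangentQ_iff.1 h
  have hA := isTangentQ_mulL_etaC h1 h2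
  set A := mulL (etaC q) p with hAdef
  -- `A` has mean zero, so antisymmetry of the primitive applies.
  have hSA : inner ℝ (toL (prim A)) A = 0 := by
    have := inner_toL_prim A A
    rw [hA.1, real_inner_comm A (toL (prim A))] at this
    rw [real_inner_comm]
    linarith
  have hS2 : prim (mulL (prim A) A) = (1 / 2 : ℝ) • (prim A * prim A) := by
    rw [prim_mul_prim, ← two_smul ℝ, smul_smul]; norm_num
  refine ⟨hA, ?_, ?_⟩
  · change inner ℝ (toL (etaC q * prim A)) p + inner ℝ (toL (etaC q)) (toL (momentumC q p)) = 0
    rw [← mulL_toL, inner_mulL, hSA, momentumC, map_add, map_smul, inner_add_right,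
      inner_smul_right, inner_etaC_tailC hq, inner_etaC_lagrC hq]
    ring
  · change inner ℝ (toL (etaC q * prim A * phiC q + etaC q * prim (toL (etaC q * prim A)))) p +
      inner ℝ (toL (etaC q * phiC q)) (toL (momentumC q p)) = 0
    have hB : coefB' q p = (3 / 2) * inner ℝ oneL (toL (prim A * prim A * etaC q)) := by
      rw [coefB', primMom, mulL_toL, inner_toL_toL, ← hAdef,
        show etaC q * prim A * prim A = prim A * prim A * etaC q by ring]
    -- The integrand is `φ` times `A ∫₀ˣ A`, the derivative of `½ (∫₀ˣ A)²`. Integration by parts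
    -- leaves `-½ ∫ η (∫₀ˣ A)²`, the boundary term being zero.
    have e1 : inner ℝ (toL (etaC q * prim A * phiC q)) p =
        -(1 / 2) * inner ℝ oneL (toL (prim A * prim A * etaC q)) := by
      rw [show etaC q * prim A * phiC q = etaC q * (prim A * phiC q) by ring, ← mulL_toL,
        inner_mulL, ← hAdef, ← mulL_toL, inner_mulL, phiC, inner_toL_prim, hS2, ← inner_toL, hSA,
        map_smul, inner_smul_right, inner_toL_toL, mul_comm (etaC q)]
      ring
    -- This comes from the variation of `φ`; the outer primitive is moved onto `A`, which has mean
    -- zero.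
    have e2 : inner ℝ (toL (etaC q * prim (toL (etaC q * prim A)))) p =
        -inner ℝ oneL (toL (prim A * prim A * etaC q)) := by
      rw [← mulL_toL, inner_mulL, ← hAdef, inner_toL_prim, hA.1, inner_toL_toL,
        show etaC q * prim A * prim A = prim A * prim A * etaC q by ring]
      ring
    rw [map_add, inner_add_left, e1, e2, momentumC, map_add, map_smul, inner_add_right,
      inner_smul_right, inner_etaC_phiC_tailC hq, inner_etaC_phiC_lagrC hq, hB]
    ring

/-- A vector orthogonal to `T_qQ` which satisfies the constraints on covectors vanishes. -/
lemma eq_zero_of_orthogonal {q r : L2} (h1 : inner ℝ (toL (etaC q)) r = 0)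
    (h2 : inner ℝ (toL (etaC q * phiC q)) r = 0)
    (h : ∀ v, IsTangentQ q v → inner ℝ r v = 0) : r = 0 := by
  have := h _ (isTangentQ_mulL_etaC h1 h2)
  rw [real_inner_comm] at this
  exact eq_zero_of_inner_etaC this

/-- The linearised constraints are affine in the fibre component once `h` is fixed. The difference
of two lifts is thus vertical and satisfies the constraints defining the fibre of `T*Q`. -/
lemma IsTangent.snd_constraints {q p : L2} {h k k' : L2} (hk : IsTangent q p (h, k))
    (hk' : IsTangent q p (h, k')) : inner ℝ (toL (etaC q)) (k - k') = 0 ∧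
      inner ℝ (toL (etaC q * phiC q)) (k - k') = 0 := by
  have e1 := hk.2
  have e2 := hk'.2
  have e3 := hk.3
  have e4 := hk'.3
  simp only at e1 e2 e3 e4
  rw [inner_sub_right, inner_sub_right]
  constructor <;> linarith

/-- A lift amounts to prescribing the pairings of `k` with `η` and `ηφ`; a combination of `1` and
`φ` realises any two values. -/
lemma exists_isTangent {q p h : L2} (hq : q ∈ Q) (hh : IsTangentQ q h) :
    ∃ k, IsTangent q p (h, k) := by
  refine ⟨toL (lagrC q (-inner ℝ (toL (etaC q * prim h)) p) (-inner ℝ (toL (etaC q * prim h *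
    phiC q + etaC q * prim (toL (etaC q * prim h)))) p)), hh, ?_, ?_⟩
  · simp only
    rw [inner_etaC_lagrC hq]; ring
  · simp only
    rw [inner_etaC_phiC_lagrC hq]; ring

/-- The symplectic form is nondegenerate on the tangent spaces of `T*Q`. -/
lemma IsTangent.eq_zero_of_symplecticForm {q p : L2} (hq : q ∈ Q) {V : L2 × L2}
    (hV : IsTangent q p V) (h : ∀ W, IsTangent q p W → symplecticForm V W = 0) : V = 0 := by
  obtain ⟨v, w⟩ := V
  have hv : v = 0 := by
    -- Testing against the vertical vector `(0, v/η)` yields `∫ v²/η = 0`.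
    have ht : IsTangent q p (0, mulL (etaC (-q)) v) := by
      refine ⟨⟨by simp, by simp⟩, ?_, ?_⟩
      · simp only [map_zero, mul_zero, inner_zero_left, zero_add]
        rw [← inner_mulL, mulL_toL, etaC_neg_mul_etaC, toL_one, hV.1.1]
      · simp only [map_zero, mul_zero, zero_mul, add_zero, inner_zero_left, zero_add]
        rw [← inner_mulL, mulL_toL, ← mul_assoc, etaC_neg_mul_etaC, one_mul, hV.1.2]
    have := h _ ht
    simp only [symplecticForm, inner_zero_right, sub_zero] at this
    rw [real_inner_comm] at this
    exact eq_zero_of_inner_etaC this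
  subst hv
  have h1 := hV.2
  have h2 := hV.3
  simp only [map_zero, mul_zero, zero_mul, add_zero, inner_zero_left, zero_add] at h1 h2
  -- Every `u` tangent to `Q` lifts to a tangent vector of `T*Q`, so `w` is orthogonal to `T_qQ`. It
  -- also satisfies the fibre constraints, hence vanishes.
  have hw : w = 0 := by
    refine eq_zero_of_orthogonal h1 h2 fun u hu => ?_
    obtain ⟨k, hk⟩ := exists_isTangent (p := p) hq hu
    have := h _ hk
    simpa [symplecticForm] using this
  rw [hw]; rfl

/-! ### The Hamiltonian -/

/-- Integration by parts turns the derivative of `∫ η p²` in the direction `h` into a pairing with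
`h`; the gradient is the tail `∫ₓ¹ η p²`. -/
lemma inner_etaC_prim_mulL (q p h : L2) :
    inner ℝ (mulL (etaC q * prim h) p) p = inner ℝ (toL (tailC q p)) h := by
  rw [tailC, map_sub, map_smul, inner_sub_left, inner_smul_left, inner_toL_primMul, toL_one,
    mulL_mulL, mul_comm (prim h)]
  simp

lemma hasFDerivAt_hamiltonian (q p : L2) : ∃ dH : (L2 × L2) →L[ℝ] ℝ,
    HasFDerivAt hamiltonian dH (q, p) ∧ ∀ W, dH W =
      inner ℝ (mulL (etaC q) p) W.2 + (1 / 2) * inner ℝ (toL (tailC q p)) W.1 := by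
  have h1 : HasFDerivAt (fun z : L2 × L2 => etaC z.1) _ (q, p) :=
    HasFDerivAt.comp (g := etaC) (q, p) (hasFDerivAt_etaC q) (hasFDerivAt_fst (p := (q, p)))
  have h2 : HasFDerivAt (fun z : L2 × L2 => mulL (etaC z.1)) _ (q, p) :=
    mulL.hasFDerivAt.comp (q, p) h1
  have h3 := ((h2.clm_apply (hasFDerivAt_snd (p := (q, p)))).inner ℝ
    (hasFDerivAt_snd (p := (q, p)))).const_mul (1 / 2 : ℝ)
  rw [show hamiltonian = _ from funext hamiltonian_eq]
  refine ⟨_, h3, fun W => ?_⟩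
  have e : inner ℝ (mulL (etaC q) W.2) p = inner ℝ (mulL (etaC q) p) W.2 := by
    rw [inner_mulL, real_inner_comm]
  simp [inner_add_left, e, inner_etaC_prim_mulL]
  ring

/-- The multiplier part of the second component lies in the span of `1` and `φ`, which is orthogonal
to `W.1`. What remains is the differential of the kinetic energy. -/
lemma symplecticForm_field {q p : L2} {W : L2 × L2} (hW : IsTangentQ q W.1) :
    symplecticForm (field q p) W =
      inner ℝ (mulL (etaC q) p) W.2 + (1 / 2) * inner ℝ (toL (tailC q p)) W.1 := by
  simp only [symplecticForm, field, momentumC, lagrC, map_add, map_smul, inner_add_left,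
    inner_smul_left, toL_one, hW.1, hW.2]
  simp

lemma symplecticForm_sub_left (V V' W : L2 × L2) :
    symplecticForm (V - V') W = symplecticForm V W - symplecticForm V' W := by
  simp only [symplecticForm, Prod.fst_sub, Prod.snd_sub, inner_sub_left]
  ring

/-! ### The chart `q ↦ ∂ₓη(q)` -/

lemma absCont_lipschitz_comp {f g : ℝ → ℝ} {a b : ℝ} {K : NNReal}
    {s : Set ℝ} (hf : AbsolutelyContinuousOnInterval f a b) (hg : LipschitzOnWith K g s)
    (hs : MapsTo f (uIcc a b) s) : AbsolutelyContinuousOnInterval (fun x => g (f x)) a b := by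
  rw [absolutelyContinuousOnInterval_iff] at hf ⊢
  intro ε hε
  -- The denominator is `K + 1` because `K` may be zero.
  obtain ⟨δ, hδ, h⟩ := hf (ε / (K + 1)) (by positivity)
  refine ⟨δ, hδ, fun E hE hEδ => ?_⟩
  have h1 : ∑ i ∈ Finset.range E.1, dist (g (f (E.2 i).1)) (g (f (E.2 i).2)) ≤
      K * ∑ i ∈ Finset.range E.1, dist (f (E.2 i).1) (f (E.2 i).2) := by
    rw [Finset.mul_sum]
    refine Finset.sum_le_sum fun i hi => hg.dist_le_mul _ (hs ?_) _ (hs ?_)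
    · exact (hE.1 i hi).1
    · exact (hE.1 i hi).2
  have h2 := h E hE hEδ
  rw [lt_div_iff₀ (by positivity)] at h2
  have h3 : 0 ≤ ∑ i ∈ Finset.range E.1, dist (f (E.2 i).1) (f (E.2 i).2) :=
    Finset.sum_nonneg fun _ _ => dist_nonneg
  nlinarith

/-- The primitive of `q` is absolutely continuous and bounded, and `exp` is Lipschitz on bounded
intervals. -/
lemma absCont_eta (q : L2) : AbsolutelyContinuousOnInterval (eta q) 0 1 := by
  have h := absCont_primitive (integrable_L2 q)
  obtain ⟨C, hC⟩ := h.exists_bound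
  obtain ⟨K, hK⟩ := (Real.contDiff_exp (n := 1)).contDiffOn.exists_lipschitzOnWith
    (s := Icc (-C) C) (by decide) (convex_Icc _ _) isCompact_Icc
  exact absCont_lipschitz_comp (f := fun x => ∫ y in (0 : ℝ)..x, q y) h hK fun x hx => abs_le.1 (hC x hx)

/-- The map `q ↦ q η(q)`, the derivative of `η(q)`. -/
def derivEta (q : L2) : L2 := mulL (etaC q) q

/-- `η` is absolutely continuous with `η' = q η` almost everywhere and `η(0) = 1`. -/
lemma etaC_eq (q : L2) : etaC q = 1 + prim (derivEta q) := by
  ext x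
  have hsub : uIcc (0 : ℝ) x ⊆ uIcc (0 : ℝ) 1 := by
    rw [uIcc_of_le x.2.1, uIcc_of_le zero_le_one]
    exact Icc_subset_Icc_right x.2.2
  have h := ((absCont_eta q).mono hsub).integral_deriv_eq_sub
  have h1 : ∫ y in (0 : ℝ)..x, deriv (eta q) y = ∫ y in (0 : ℝ)..x, derivEta q y := by
    refine intervalIntegral_congr_μI ?_ zero_mem_I x.2
    filter_upwards [ae_hasDerivAt_primitive (integrable_L2 q), coeFn_mulL (etaC q) q,
      ae_restrict_mem measurableSet_Icc] with y hy h1 hy'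
    rw [derivEta, h1, extI_etaC q hy']
    exact hy.exp.deriv
  have h0 : eta q 0 = 1 := by simp [eta]
  rw [ContinuousMap.add_apply, prim_apply, etaC_apply, ContinuousMap.one_apply, ← h1, h, h0]
  ring

/-- The inverse `w ↦ w / (1 + ∫₀ˣ w)` of `q ↦ q η(q)`. -/
def logDerivMap (w : L2) : L2 := mulL (Ring.inverse (1 + prim w)) w

lemma ringInverse_etaC (q : L2) : Ring.inverse (etaC q) = etaC (-q) :=
  Ring.inverse_unit ⟨etaC q, etaC (-q), etaC_mul_etaC_neg q, etaC_neg_mul_etaC q⟩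

lemma logDerivMap_derivEta (q : L2) : logDerivMap (derivEta q) = q := by
  rw [logDerivMap, ← etaC_eq, ringInverse_etaC, derivEta, mulL_mulL, etaC_neg_mul_etaC, one_mulL]

/-- Uniqueness for the equation `u' = q u`. -/
lemma etaC_unique {q w : L2} (h : mulL (1 + prim w) q = w) : etaC q = 1 + prim w := by
  -- The function `(1 + ∫₀ˣ w) η(-q)` equals `1` at `0`, and its derivative `w η(-q) - (1 + ∫₀ˣ w) q
  -- η(-q)` is zero. The computation uses the Leibniz rule on primitives.
  have h1 := etaC_eq (-q)
  have h2 := prim_mul_prim w (derivEta (-q))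
  have h3 : mulL (prim w) (derivEta (-q)) =
      -mulL (etaC (-q)) w - derivEta (-q) := by
    conv_rhs => rw [← h]
    simp only [derivEta, map_neg, mulL_mulL, map_add, add_apply, mul_one]
    rw [mul_comm]
    abel
  have h4 : mulL (prim (derivEta (-q))) w = mulL (etaC (-q)) w - w := by
    rw [h1, map_add, add_apply, one_mulL]; abel
  have h5 : (1 + prim w) * etaC (-q) = 1 := by
    rw [h1, mul_add, mul_one, add_mul, one_mul, h2, h3, h4]
    simp only [map_sub, map_neg]
    abel
  calc etaC q = (1 + prim w) * etaC (-q) * etaC q := by rw [h5, one_mul]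
    _ = 1 + prim w := by rw [mul_assoc, etaC_neg_mul_etaC, mul_one]

lemma mulL_logDerivMap {w : L2} (hw : IsUnit (1 + prim w)) :
    mulL (1 + prim w) (logDerivMap w) = w := by
  rw [logDerivMap, mulL_mulL, Ring.mul_inverse_cancel _ hw, one_mulL]

lemma etaC_logDerivMap {w : L2} (hw : IsUnit (1 + prim w)) :
    etaC (logDerivMap w) = 1 + prim w := etaC_unique (mulL_logDerivMap hw)

lemma derivEta_logDerivMap {w : L2} (hw : IsUnit (1 + prim w)) :
    derivEta (logDerivMap w) = w := by
  rw [derivEta, etaC_logDerivMap hw, mulL_logDerivMap hw]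

lemma isUnit_etaC (q : L2) : IsUnit (etaC q) :=
  ⟨⟨etaC q, etaC (-q), etaC_mul_etaC_neg q, etaC_neg_mul_etaC q⟩, rfl⟩

lemma isUnit_derivEta (q : L2) : IsUnit (1 + prim (derivEta q)) := by
  rw [← etaC_eq]; exact isUnit_etaC q

lemma contDiff_derivEta {n : WithTop ℕ∞} : ContDiff ℝ n derivEta :=
  (mulL.contDiff.comp contDiff_etaC).clm_apply contDiff_id

/-- Inversion in a Banach algebra is smooth at units, and `mulL` is bilinear and continuous. -/
lemma contDiffAt_logDerivMap {n : WithTop ℕ∞} {w : L2} (hw : IsUnit (1 + prim w)) :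
    ContDiffAt ℝ n logDerivMap w := by
  obtain ⟨u, hu⟩ := hw
  have h1 : ContDiffAt ℝ n (fun w => Ring.inverse (1 + prim w)) w := by
    have h2 : ContDiffAt ℝ n Ring.inverse (1 + prim w) := by
      rw [← hu]; exact contDiffAt_ringInverse ℝ u
    exact h2.comp w (contDiffAt_const.add prim.contDiff.contDiffAt)
  exact (mulL.contDiff.contDiffAt.comp w h1).clm_apply contDiffAt_id

lemma isOpen_isUnit_prim : IsOpen {w : L2 | IsUnit (1 + prim w)} :=
  Units.isOpen.preimage (continuous_const.add prim.continuous)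

/-- The second derivatives of the elements of `H₀²`. -/
def secondDerivSubmodule : Submodule ℝ L2 where
  carrier := {w | inner ℝ oneL w = 0 ∧ inner ℝ oneL (toL (prim w)) = 0}
  zero_mem' := by simp
  add_mem' := by
    rintro u v ⟨h1, h2⟩ ⟨h3, h4⟩
    refine ⟨?_, ?_⟩
    · rw [inner_add_right, h1, h3, add_zero]
    · rw [map_add, map_add, inner_add_right, h2, h4, add_zero]
  smul_mem' := by
    rintro c u ⟨h1, h2⟩
    refine ⟨?_, ?_⟩
    · rw [inner_smul_right, h1, mul_zero]
    · rw [map_smul, map_smul, inner_smul_right, h2, mul_zero]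

lemma mem_secondDerivSubmodule {w : L2} : w ∈ secondDerivSubmodule ↔
    inner ℝ oneL w = 0 ∧ inner ℝ oneL (toL (prim w)) = 0 := Iff.rfl

lemma inner_oneL_oneL : inner ℝ oneL oneL = 1 := by
  have h : inner ℝ oneL oneL = ∫ x in (0 : ℝ)..1, (1 : ℝ) := by
    rw [inner_eq_integral, ← intervalIntegral_eq_integral_μI]
    refine intervalIntegral_congr_μI ?_ zero_mem_I one_mem_I
    filter_upwards [coeFn_oneL] with x hx
    rw [hx, one_mul]
  rw [h]; simp

/-- The chart straightens `Q`: the two linear functionals take the values `exp (∫ q) - 1` and `∫ η -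
1` at `q η`, and these vanish exactly on `Q`. -/
lemma derivEta_mem {q : L2} : derivEta q ∈ secondDerivSubmodule ↔ q ∈ Q := by
  have h1 : inner ℝ oneL (derivEta q) = Real.exp (inner ℝ oneL q) - 1 := by
    have := congrArg (fun g : CI => g oneI) (etaC_eq q)
    simp only [ContinuousMap.add_apply, ContinuousMap.one_apply, prim_oneI, etaC,
      exp_apply_CI] at this
    rw [this]; ring
  have h2 : inner ℝ oneL (toL (prim (derivEta q))) = inner ℝ oneL (toL (etaC q)) - 1 := by
    rw [etaC_eq q, map_add, inner_add_right, toL_one, inner_oneL_oneL]; ring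
  rw [mem_secondDerivSubmodule, mem_Q_iff, h1, h2, sub_eq_zero, sub_eq_zero, Real.exp_eq_one_iff]

lemma logDerivMap_mem_Q {w : L2} (hw : IsUnit (1 + prim w)) (hw' : w ∈ secondDerivSubmodule) :
    logDerivMap w ∈ Q := by
  rwa [← derivEta_mem, derivEta_logDerivMap hw]

lemma fderiv_logDerivMap_derivEta (q h : L2) :
    fderiv ℝ logDerivMap (derivEta q) (fderiv ℝ derivEta q h) = h := by
  have h1 : HasFDerivAt derivEta (fderiv ℝ derivEta q) q :=
    (contDiff_derivEta (n := 1)).differentiable (by simp) q |>.hasFDerivAt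
  have h2 : HasFDerivAt logDerivMap (fderiv ℝ logDerivMap (derivEta q)) (derivEta q) :=
    (contDiffAt_logDerivMap (n := 1) (isUnit_derivEta q)).differentiableAt (by simp) |>.hasFDerivAt
  have h3 := (h2.comp q h1).unique
    ((hasFDerivAt_id q).congr_of_eventuallyEq (Eventually.of_forall logDerivMap_derivEta))
  exact congrArg (fun L : L2 →L[ℝ] L2 => L h) h3

/-- Differentiate `η = 1 + ∫₀ˣ (q η)` in `q` and compare with the derivative of the exponential. -/
lemma prim_fderiv_derivEta (q h : L2) : prim (fderiv ℝ derivEta q h) = etaC q * prim h := by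
  have h1 : HasFDerivAt derivEta (fderiv ℝ derivEta q) q :=
    (contDiff_derivEta (n := 1)).differentiable (by simp) q |>.hasFDerivAt
  have h2 : HasFDerivAt etaC (prim.comp (fderiv ℝ derivEta q)) q := by
    rw [show etaC = fun q => 1 + prim (derivEta q) from funext etaC_eq]
    exact (prim.hasFDerivAt.comp q h1).const_add 1
  exact congrArg (fun L : L2 →L[ℝ] CI => L h) (h2.unique (hasFDerivAt_etaC q))

/-- The derivative of the second constraint. -/
lemma inner_one_etaC_prim {q : L2} (hq : q ∈ Q) (h : L2) :
    inner ℝ oneL (toL (etaC q * prim h)) = inner ℝ oneL h - inner ℝ (toL (phiC q)) h := by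
  have := inner_toL_prim (toL (etaC q)) h
  rw [inner_one_etaC hq, inner_toL_toL] at this
  change inner ℝ (toL (phiC q)) h = _ at this
  rw [this]; ring

lemma fderiv_derivEta_mem {q h : L2} (hq : q ∈ Q) (hh : IsTangentQ q h) :
    fderiv ℝ derivEta q h ∈ secondDerivSubmodule := by
  rw [mem_secondDerivSubmodule, ← prim_oneI, prim_fderiv_derivEta, ContinuousMap.mul_apply,
    prim_oneI, hh.1, inner_one_etaC_prim hq, hh.1, hh.2]
  simp

/-! ### Curves in `Q` and in `T*Q` -/

/-- A straight line in the chart. It stays in the linear subspace, and for small `s` in the open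
domain of the inverse chart. -/
lemma exists_curve_Q {q h : L2} (hq : q ∈ Q) (hh : IsTangentQ q h) :
    ∃ c : ℝ → L2, c 0 = q ∧ HasDerivAt c h 0 ∧ ∀ᶠ s in 𝓝 (0 : ℝ), c s ∈ Q := by
  have hl : HasDerivAt (fun s : ℝ => derivEta q + s • fderiv ℝ derivEta q h)
      (fderiv ℝ derivEta q h) 0 := by
    simpa using ((hasDerivAt_id (0 : ℝ)).smul_const (fderiv ℝ derivEta q h)).const_add (derivEta q)
  have h0 : derivEta q + (0 : ℝ) • fderiv ℝ derivEta q h = derivEta q := by simp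
  refine ⟨fun s => logDerivMap (derivEta q + s • fderiv ℝ derivEta q h), ?_, ?_, ?_⟩
  · simp only [h0, logDerivMap_derivEta]
  · have h2 : HasFDerivAt logDerivMap (fderiv ℝ logDerivMap (derivEta q))
        (derivEta q + (0 : ℝ) • fderiv ℝ derivEta q h) := by
      rw [h0]
      exact (contDiffAt_logDerivMap (n := 1) (isUnit_derivEta q)).differentiableAt
        (by simp) |>.hasFDerivAt
    have := h2.comp_hasDerivAt 0 hl
    rwa [fderiv_logDerivMap_derivEta] at this
  · have hev : ∀ᶠ s in 𝓝 (0 : ℝ),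
        IsUnit (1 + prim (derivEta q + s • fderiv ℝ derivEta q h)) := by
      refine hl.continuousAt.eventually (isOpen_isUnit_prim.mem_nhds ?_)
      simp only [h0]
      exact isUnit_derivEta q
    filter_upwards [hev] with s hs
    exact logDerivMap_mem_Q hs (add_mem (derivEta_mem.2 hq)
      (Submodule.smul_mem _ _ (fderiv_derivEta_mem hq hh)))

lemma mem_tangentConeAt_of_curve {E : Type*} [NormedAddCommGroup E] [NormedSpace ℝ E] {s : Set E}
    {c : ℝ → E} {v : E} (hc : HasDerivAt c v 0) (hs : ∀ᶠ t in 𝓝 (0 : ℝ), c t ∈ s) :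
    v ∈ tangentConeAt ℝ s (c 0) := by
  refine mem_tangentConeAt_of_seq (𝓝[≠] (0 : ℝ)) (fun t => t⁻¹) (fun t => c t - c 0) ?_ ?_ ?_
  · have := (hc.continuousAt.tendsto.sub_const (c 0)).mono_left
      (nhdsWithin_le_nhds (s := {(0 : ℝ)}ᶜ))
    simpa using this
  · filter_upwards [nhdsWithin_le_nhds hs] with t ht
    simpa using ht
  · have := hasDerivAt_iff_tendsto_slope.1 hc
    refine this.congr fun t => ?_
    simp [slope_def_module]

/-! The constraints defining `Q` and `T*Q`, and their derivatives. -/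

lemma hasFDerivAt_constraint_one (q : L2) : ∃ D : L2 →L[ℝ] ℝ,
    HasFDerivAt (fun q => inner ℝ oneL q) D q ∧ ∀ h, D h = inner ℝ oneL h :=
  ⟨innerSL ℝ oneL, (innerSL ℝ oneL).hasFDerivAt, fun _ => rfl⟩

lemma hasFDerivAt_constraint_eta {q : L2} (hq : q ∈ Q) : ∃ D : L2 →L[ℝ] ℝ,
    HasFDerivAt (fun q => inner ℝ oneL (toL (etaC q))) D q ∧
      ∀ h, D h = inner ℝ oneL h - inner ℝ (toL (phiC q)) h := by
  refine ⟨_, ((innerSL ℝ oneL).comp toL).hasFDerivAt.comp q (hasFDerivAt_etaC q), fun h => ?_⟩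
  rw [← inner_one_etaC_prim hq]
  rfl

lemma hasFDerivAt_constraint_mom (q p : L2) : ∃ D : (L2 × L2) →L[ℝ] ℝ,
    HasFDerivAt (fun z : L2 × L2 => inner ℝ (toL (etaC z.1)) z.2) D (q, p) ∧
      ∀ V, D V = inner ℝ (toL (etaC q * prim V.1)) p + inner ℝ (toL (etaC q)) V.2 := by
  have h1 : HasFDerivAt (fun z : L2 × L2 => etaC z.1) _ (q, p) :=
    HasFDerivAt.comp (g := etaC) (q, p) (hasFDerivAt_etaC q) (hasFDerivAt_fst (p := (q, p)))
  have h2 := (toL.hasFDerivAt.comp (q, p) h1).inner ℝ (hasFDerivAt_snd (p := (q, p)))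
  refine ⟨_, h2, fun V => ?_⟩
  simp
  ring

lemma hasFDerivAt_constraint_mom_phi (q p : L2) : ∃ D : (L2 × L2) →L[ℝ] ℝ,
    HasFDerivAt (fun z : L2 × L2 => inner ℝ (toL (etaC z.1 * phiC z.1)) z.2) D (q, p) ∧
      ∀ V, D V = inner ℝ (toL (etaC q * prim V.1 * phiC q +
        etaC q * prim (toL (etaC q * prim V.1)))) p + inner ℝ (toL (etaC q * phiC q)) V.2 := by
  have h1 : HasFDerivAt (fun z : L2 × L2 => etaC z.1) _ (q, p) :=
    HasFDerivAt.comp (g := etaC) (q, p) (hasFDerivAt_etaC q) (hasFDerivAt_fst (p := (q, p)))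
  have h1' : HasFDerivAt (fun z : L2 × L2 => phiC z.1) _ (q, p) :=
    HasFDerivAt.comp (g := phiC) (q, p) (hasFDerivAt_phiC q) (hasFDerivAt_fst (p := (q, p)))
  have h2 := (toL.hasFDerivAt.comp (q, p) (h1.mul h1')).inner ℝ (hasFDerivAt_snd (p := (q, p)))
  refine ⟨_, h2, fun V => ?_⟩
  simp [inner_add_left, mul_comm]
  ring

/-- The derivative of `F` sends the tangent cone of `s` into the tangent cone of the single point `F
x`, which is zero. -/
lemma eq_zero_of_mem_tangentConeAt {E : Type*} [NormedAddCommGroup E] [NormedSpace ℝ E]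
    {s : Set E} {x v : E} (hv : v ∈ tangentConeAt ℝ s x) {F : E → ℝ} {D : E →L[ℝ] ℝ}
    (hF : HasFDerivAt F D x) {c : ℝ} (hx : F x = c) (hs : ∀ y ∈ s, F y = c) : D v = 0 := by
  have h := (hF.hasFDerivWithinAt (s := s)).mapsTo_tangent_cone hv
  have h2 : F '' s ⊆ {F x} := by
    rintro _ ⟨y, hy, rfl⟩
    rw [mem_singleton_iff, hs y hy, hx]
  have h3 := tangentConeAt_mono h2 h
  have h4 := tangentConeAt_subset_zero (𝕜 := ℝ) (s := {F x}) (x := F x)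
    (fun hacc => by simpa using accPt_iff_nhds.1 hacc univ univ_mem) h3
  simpa using h4

lemma isTangent_of_mem_tangentConeAt {q p : L2} (h : (q, p) ∈ cotangentQ) {V : L2 × L2}
    (hV : V ∈ tangentConeAt ℝ cotangentQ (q, p)) : IsTangent q p V := by
  obtain ⟨hq, h1, h2⟩ := mem_cotangentQ_iff.1 h
  obtain ⟨D1, hD1, e1⟩ := hasFDerivAt_constraint_one q
  obtain ⟨D2, hD2, e2⟩ := hasFDerivAt_constraint_eta hq
  obtain ⟨D3, hD3, e3⟩ := hasFDerivAt_constraint_mom q p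
  obtain ⟨D4, hD4, e4⟩ := hasFDerivAt_constraint_mom_phi q p
  have hmem : ∀ y ∈ cotangentQ, y.1 ∈ Q ∧ inner ℝ (toL (etaC y.1)) y.2 = 0 ∧
      inner ℝ (toL (etaC y.1 * phiC y.1)) y.2 = 0 := fun y hy => mem_cotangentQ_iff.1 hy
  have f1 := eq_zero_of_mem_tangentConeAt hV (F := fun z : L2 × L2 => inner ℝ oneL z.1)
    (HasFDerivAt.comp (g := fun q : L2 => inner ℝ oneL q) (q, p) hD1
      (hasFDerivAt_fst (p := (q, p)))) (mem_Q_iff.1 hq).1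
    fun y hy => (mem_Q_iff.1 (hmem y hy).1).1
  have f2 := eq_zero_of_mem_tangentConeAt hV
    (F := fun z : L2 × L2 => inner ℝ oneL (toL (etaC z.1)))
    (HasFDerivAt.comp (g := fun q : L2 => inner ℝ oneL (toL (etaC q))) (q, p) hD2
      (hasFDerivAt_fst (p := (q, p)))) (mem_Q_iff.1 hq).2
    fun y hy => (mem_Q_iff.1 (hmem y hy).1).2
  have f3 := eq_zero_of_mem_tangentConeAt hV hD3 h1 fun y hy => (hmem y hy).2.1
  have f4 := eq_zero_of_mem_tangentConeAt hV hD4 h2 fun y hy => (hmem y hy).2.2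
  have g1 : inner ℝ oneL V.1 = 0 := (e1 V.1).symm.trans f1
  have g2 : inner ℝ oneL V.1 - inner ℝ (toL (phiC q)) V.1 = 0 := (e2 V.1).symm.trans f2
  refine ⟨⟨g1, by linarith⟩, ?_, ?_⟩
  · rw [← e3, f3]
  · rw [← e4, f4]

/-- Lift `V.1` to a curve in `Q`, move `p` along a line, and correct it by a combination of `1` and
`φ` to restore the two fibre constraints. The defects `F3`, `F4` vanish to first order since `V`
satisfies the linearised constraints, so the correction does not change the velocity. -/
lemma mem_tangentConeAt_of_isTangent {q p : L2} (h : (q, p) ∈ cotangentQ) {V : L2 × L2}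
    (hV : IsTangent q p V) : V ∈ tangentConeAt ℝ cotangentQ (q, p) := by
  obtain ⟨hq, h1, h2⟩ := mem_cotangentQ_iff.1 h
  obtain ⟨c, hc0, hc, hcQ⟩ := exists_curve_Q hq hV.1
  obtain ⟨D3, hD3, e3⟩ := hasFDerivAt_constraint_mom q p
  obtain ⟨D4, hD4, e4⟩ := hasFDerivAt_constraint_mom_phi q p
  have hl : HasDerivAt (fun s : ℝ => p + s • V.2) V.2 0 := by
    simpa using ((hasDerivAt_id (0 : ℝ)).smul_const V.2).const_add p
  have hz0 : (c 0, p + (0 : ℝ) • V.2) = (q, p) := by simp [hc0]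
  have hz : HasDerivAt (fun s : ℝ => (c s, p + s • V.2)) V 0 := hc.prodMk hl
  set F3 : ℝ → ℝ := fun s => inner ℝ (toL (etaC (c s))) (p + s • V.2) with hF3
  set F4 : ℝ → ℝ := fun s => inner ℝ (toL (etaC (c s) * phiC (c s))) (p + s • V.2) with hF4
  have d3 : HasDerivAt F3 0 0 := by
    have := HasFDerivAt.comp_hasDerivAt (l := fun z : L2 × L2 => inner ℝ (toL (etaC z.1)) z.2)
      (0 : ℝ) (by rw [hz0]; exact hD3) hz
    rwa [e3, hV.2] at this
  have d4 : HasDerivAt F4 0 0 := by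
    have := HasFDerivAt.comp_hasDerivAt
      (l := fun z : L2 × L2 => inner ℝ (toL (etaC z.1 * phiC z.1)) z.2)
      (0 : ℝ) (by rw [hz0]; exact hD4) hz
    rwa [e4, hV.3] at this
  have z3 : F3 0 = 0 := by simp only [hF3, hc0, zero_smul, add_zero, h1]
  have z4 : F4 0 = 0 := by simp only [hF4, hc0, zero_smul, add_zero, h2]
  have dphi : HasDerivAt (fun s => phiC (c s)) _ 0 :=
    HasFDerivAt.comp_hasDerivAt (l := phiC) (0 : ℝ) (by rw [hc0]; exact hasFDerivAt_phiC q) hc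
  have dl : HasDerivAt (fun s => toL (lagrC (c s) (F3 s) (F4 s))) 0 0 := by
    have a1 := (((d3.const_mul 4).sub (d4.const_mul 6)).smul_const (1 : CI)).add
      (((d3.const_mul (-6)).add (d4.const_mul 12)).smul dphi)
    have a2 := toL.hasFDerivAt.comp_hasDerivAt (0 : ℝ) a1
    simp only [lagrC]
    refine HasDerivAt.congr_deriv a2 ?_
    simp [z3, z4]
  have hγ : HasDerivAt (fun s => (c s, p + s • V.2 - toL (lagrC (c s) (F3 s) (F4 s)))) V 0 := by
    have := hc.prodMk (hl.sub dl)
    rwa [sub_zero] at this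
  have key := mem_tangentConeAt_of_curve hγ (s := cotangentQ) ?_
  · simp only [hc0, z3, z4] at key
    simpa [lagrC] using key
  · filter_upwards [hcQ] with s hs
    refine mem_cotangentQ_iff.2 ⟨hs, ?_, ?_⟩
    · rw [inner_sub_right, inner_etaC_lagrC hs]; exact sub_self _
    · rw [inner_sub_right, inner_etaC_phiC_lagrC hs]; exact sub_self _

lemma mem_tangentConeAt_iff {q p : L2} (h : (q, p) ∈ cotangentQ) {V : L2 × L2} :
    V ∈ tangentConeAt ℝ cotangentQ (q, p) ↔ IsTangent q p V :=
  ⟨isTangent_of_mem_tangentConeAt h, mem_tangentConeAt_of_isTangent h⟩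

/-- The system is the Hamiltonian system of the kinetic energy. -/
theorem hamiltonian_vectorField {q p : L2} (h : (q, p) ∈ cotangentQ) :
    ∃ dH : (L2 × L2) →L[ℝ] ℝ, HasFDerivAt hamiltonian dH (q, p) ∧
      ∃ X ∈ tangentConeAt ℝ cotangentQ (q, p), IsFieldAt q p X ∧
        ∀ V ∈ tangentConeAt ℝ cotangentQ (q, p),
          (∀ W ∈ tangentConeAt ℝ cotangentQ (q, p), symplecticForm V W = dH W) ↔ V = X := by
  have hq : q ∈ Q := h.1
  obtain ⟨dH, hdH, e⟩ := hasFDerivAt_hamiltonian q p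
  have hX := isTangent_field h
  have hω : ∀ W, IsTangent q p W → symplecticForm (field q p) W = dH W := fun W hW => by
    rw [e, symplecticForm_field hW.1]
  refine ⟨dH, hdH, field q p, (mem_tangentConeAt_iff h).2 hX, (isFieldAt_iff hq p _).2 rfl,
    fun V hV => ⟨fun hVW => ?_, ?_⟩⟩
  · have hV' := (mem_tangentConeAt_iff h).1 hV
    refine sub_eq_zero.1 ((hV'.sub hX).eq_zero_of_symplecticForm hq fun W hW => ?_)
    rw [symplecticForm_sub_left, hVW W ((mem_tangentConeAt_iff h).2 hW), hω W hW, sub_self]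
  · rintro rfl W hW
    exact hω W ((mem_tangentConeAt_iff h).1 hW)

/-! ### The first variation formula -/

section FirstVariation

variable {E : Type*} [NormedAddCommGroup E] [NormedSpace ℝ E]

/-- The first variation of the action of a Lagrangian `L`. -/
theorem first_variation {M : Set E} {a b ε : ℝ} (hab : a < b) (hε : 0 < ε) {γ : ℝ → E}
    {Γ : ℝ → ℝ → E} (hΓ : IsVariation M a b γ ε Γ) {L : E × E → ℝ} (hL : ContDiff ℝ 1 L) :
    ∃ δ δ' : ℝ → E, (∀ t ∈ Icc a b, HasDerivAt (fun s => Γ s t) (δ t) 0) ∧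
      (∀ t ∈ Icc a b, HasDerivWithinAt δ (δ' t) (Icc a b) t) ∧ ContinuousOn δ' (Icc a b) ∧
      δ a = 0 ∧ δ b = 0 ∧
      HasDerivAt (fun s => ∫ t in a..b, L (Γ s t, derivWithin (Γ s) (Icc a b) t))
        (∫ t in a..b, fderiv ℝ L (γ t, derivWithin γ (Icc a b) t) (δ t, δ' t)) 0 := by
  set S : Set (ℝ × ℝ) := Ioo (-ε) ε ×ˢ Icc a b with hSdef
  set g : ℝ × ℝ → E := fun z => Γ z.1 z.2 with hg
  have hS : UniqueDiffOn ℝ S := isOpen_Ioo.uniqueDiffOn.prod (uniqueDiffOn_Icc hab)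
  set A : ℝ × ℝ → (ℝ × ℝ →L[ℝ] E) := fderivWithin ℝ g S with hA
  set A' : ℝ × ℝ → (ℝ × ℝ →L[ℝ] ℝ × ℝ →L[ℝ] E) := fderivWithin ℝ A S with hA'
  have hgC : ContDiffOn ℝ 2 g S := hΓ.contDiffOn
  have hAC : ContDiffOn ℝ 1 A S := hgC.fderivWithin hS (by norm_num)
  have hA'C : ContinuousOn A' S := hAC.continuousOn_fderivWithin hS le_rfl
  have hgd : ∀ z ∈ S, HasFDerivWithinAt g (A z) S z := fun z hz =>
    (hgC.differentiableOn (by norm_num) z hz).hasFDerivWithinAt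
  have hAd : ∀ z ∈ S, ∀ v, HasFDerivWithinAt (fun z => A z v) ((A' z).flip v) S z := by
    intro z hz v
    have h := (hAC.differentiableOn (by norm_num) z hz).hasFDerivWithinAt.clm_apply
      (hasFDerivWithinAt_const v z S)
    refine h.congr_fderiv ?_
    ext <;> simp [hA']
  -- Symmetry persists on the edges `t = a` and `t = b` because they lie in the closure of the
  -- interior of `S`. It is what identifies the `s`-derivative of the velocity with the
  -- `t`-derivative of `δ`.
  have hsymm : ∀ z ∈ S, ∀ v w, A' z v w = A' z w v := by
    intro z hz v w
    refine (hgC z hz).isSymmSndFDerivWithinAt (by simp) hS ?_ hz v w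
    rw [hSdef, interior_prod_eq, interior_Icc, isOpen_Ioo.interior_eq, closure_prod_eq,
      closure_Ioo (by linarith), closure_Ioo hab.ne]
    exact ⟨Ioo_subset_Icc_self hz.1, hz.2⟩
  -- restriction to the coordinate lines
  have hline_t : ∀ {F : Type _} [NormedAddCommGroup F] [NormedSpace ℝ F] {f : ℝ × ℝ → F}
      {f' : ℝ × ℝ →L[ℝ] F} {s t : ℝ}, s ∈ Ioo (-ε) ε → HasFDerivWithinAt f f' S (s, t) →
      HasDerivWithinAt (fun t => f (s, t)) (f' (0, 1)) (Icc a b) t := by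
    intro F _ _ f f' s t hs hf
    have h1 : HasDerivWithinAt (fun t : ℝ => (s, t)) ((0 : ℝ), (1 : ℝ)) (Icc a b) t :=
      (hasDerivWithinAt_const t (Icc a b) s).prodMk (hasDerivWithinAt_id t (Icc a b))
    exact hf.comp_hasDerivWithinAt t h1 fun t ht => ⟨hs, ht⟩
  have hline_s : ∀ {F : Type _} [NormedAddCommGroup F] [NormedSpace ℝ F] {f : ℝ × ℝ → F}
      {f' : ℝ × ℝ →L[ℝ] F} {s t : ℝ}, s ∈ Ioo (-ε) ε → t ∈ Icc a b →
      HasFDerivWithinAt f f' S (s, t) → HasDerivAt (fun s => f (s, t)) (f' (1, 0)) s := by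
    intro F _ _ f f' s t hs ht hf
    have h1 : HasDerivWithinAt (fun s : ℝ => (s, t)) ((1 : ℝ), (0 : ℝ)) (Ioo (-ε) ε) s :=
      (hasDerivWithinAt_id s (Ioo (-ε) ε)).prodMk (hasDerivWithinAt_const s (Ioo (-ε) ε) t)
    have h2 : MapsTo (fun s : ℝ => (s, t)) (Ioo (-ε) ε) S := fun s hs => ⟨hs, ht⟩
    exact (hf.comp_hasDerivWithinAt s h1 h2).hasDerivAt
      (isOpen_Ioo.mem_nhds hs)
  have h0 : (0 : ℝ) ∈ Ioo (-ε) ε := ⟨by linarith, hε⟩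
  have hder : ∀ s ∈ Ioo (-ε) ε, ∀ t ∈ Icc a b,
      derivWithin (Γ s) (Icc a b) t = A (s, t) (0, 1) := fun s hs t ht =>
    (hline_t hs (hgd (s, t) ⟨hs, ht⟩)).derivWithin (uniqueDiffOn_Icc hab t ht)
  have hslice : ∀ s ∈ Ioo (-ε) ε, ContinuousOn (fun t : ℝ => (s, t)) (Icc a b) :=
    fun s _ => by fun_prop
  have hmaps : ∀ s ∈ Ioo (-ε) ε, MapsTo (fun t : ℝ => (s, t)) (Icc a b) S :=
    fun s hs t ht => ⟨hs, ht⟩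
  set P : ℝ × ℝ → E × E := fun z => (g z, A z (0, 1)) with hP
  have hPC : ContinuousOn P S :=
    hgC.continuousOn.prodMk (hAC.continuousOn.clm_apply continuousOn_const)
  set F' : ℝ × ℝ → ℝ := fun z => fderiv ℝ L (P z) (A z (1, 0), A' z (1, 0) (0, 1)) with hF'
  have hF'C : ContinuousOn F' S := by
    refine ((hL.continuous_fderiv (by norm_num)).comp_continuousOn hPC).clm_apply ?_
    exact (hAC.continuousOn.clm_apply continuousOn_const).prodMk
      ((hA'C.clm_apply continuousOn_const).clm_apply continuousOn_const)
  have hderF : ∀ s ∈ Ioo (-ε) ε, ∀ t ∈ Icc a b,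
      HasDerivAt (fun s => L (P (s, t))) (F' (s, t)) s := by
    intro s hs t ht
    have h1 := hline_s hs ht (hgd (s, t) ⟨hs, ht⟩)
    have h2 := hline_s hs ht (hAd (s, t) ⟨hs, ht⟩ (0, 1))
    exact ((hL.differentiable (by norm_num)) (P (s, t))).hasFDerivAt.comp_hasDerivAt s
      (h1.prodMk h2)
  refine ⟨fun t => A (0, t) (1, 0), fun t => A' (0, t) (0, 1) (1, 0), fun t ht => ?_,
    fun t ht => ?_, ?_, ?_, ?_, ?_⟩
  · exact hline_s h0 ht (hgd (0, t) ⟨h0, ht⟩)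
  · exact hline_t h0 (hAd (0, t) ⟨h0, ht⟩ (1, 0))
  · exact ((hA'C.comp (hslice 0 h0) (hmaps 0 h0)).clm_apply continuousOn_const).clm_apply
      continuousOn_const
  · have h1 := hline_s h0 (left_mem_Icc.2 hab.le) (hgd (0, a) ⟨h0, left_mem_Icc.2 hab.le⟩)
    have h2 : HasDerivAt (fun s => g (s, a)) 0 0 := by
      refine (hasDerivAt_const (0 : ℝ) (γ a)).congr_of_eventuallyEq ?_
      filter_upwards [isOpen_Ioo.mem_nhds h0] with s hs
      exact hΓ.eq_left s hs
    exact h1.unique h2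
  · have h1 := hline_s h0 (right_mem_Icc.2 hab.le) (hgd (0, b) ⟨h0, right_mem_Icc.2 hab.le⟩)
    have h2 : HasDerivAt (fun s => g (s, b)) 0 0 := by
      refine (hasDerivAt_const (0 : ℝ) (γ b)).congr_of_eventuallyEq ?_
      filter_upwards [isOpen_Ioo.mem_nhds h0] with s hs
      exact hΓ.eq_right s hs
    exact h1.unique h2
  · have hsub : uIoc a b ⊆ Icc a b := by rw [uIoc_of_le hab.le]; exact Ioc_subset_Icc_self
    -- Differentiation under the integral sign: on `|s| ≤ ε/2` the derivative of the integrand is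
    -- bounded by compactness, and a constant serves as dominating function.
    have hK : IsCompact (Icc (-(ε / 2)) (ε / 2) ×ˢ Icc a b) := isCompact_Icc.prod isCompact_Icc
    have hKS : Icc (-(ε / 2)) (ε / 2) ×ˢ Icc a b ⊆ S :=
      prod_mono_left fun s hs => ⟨by linarith [hs.1], by linarith [hs.2]⟩
    obtain ⟨C, hC⟩ := hK.exists_bound_of_continuousOn (hF'C.mono hKS)
    have hcont : ∀ s ∈ Ioo (-ε) ε, ContinuousOn (fun t => L (P (s, t))) (Icc a b) := fun s hs =>
      hL.continuous.comp_continuousOn (hPC.comp (hslice s hs) (hmaps s hs))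
    have key := (intervalIntegral.hasDerivAt_integral_of_dominated_loc_of_deriv_le
      (μ := volume) (a := a) (b := b) (F := fun s t => L (P (s, t))) (F' := fun s t => F' (s, t))
      (x₀ := 0) (s := Icc (-(ε / 2)) (ε / 2)) (bound := fun _ => C)
      (Icc_mem_nhds (by linarith) (by linarith)) ?_ ?_ ?_ ?_ ?_ ?_).2
    · refine (key.congr_of_eventuallyEq ?_).congr_deriv ?_
      · filter_upwards [isOpen_Ioo.mem_nhds h0] with s hs
        refine intervalIntegral.integral_congr fun t ht => ?_
        rw [uIcc_of_le hab.le] at ht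
        simp only [hder s hs t ht, hP, hg]
      · refine intervalIntegral.integral_congr fun t ht => ?_
        rw [uIcc_of_le hab.le] at ht
        have e1 : derivWithin γ (Icc a b) t = A (0, t) (0, 1) := by
          rw [← hder 0 h0 t ht]
          exact derivWithin_congr (fun u hu => (hΓ.eq_zero u hu).symm) (hΓ.eq_zero t ht).symm
        simp only [hF', hP, hg]
        rw [hΓ.eq_zero t ht, e1, hsymm (0, t) ⟨h0, ht⟩]
    · filter_upwards [isOpen_Ioo.mem_nhds h0] with s hs
      exact ((hcont s hs).mono hsub).aestronglyMeasurable measurableSet_uIoc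
    · exact ContinuousOn.intervalIntegrable_of_Icc hab.le (hcont 0 h0)
    · exact ((hF'C.comp (hslice 0 h0) (hmaps 0 h0)).mono hsub).aestronglyMeasurable
        measurableSet_uIoc
    · exact Eventually.of_forall fun t ht s hs => hC (s, t) ⟨hs, hsub ht⟩
    · exact intervalIntegrable_const
    · exact Eventually.of_forall fun t ht s hs =>
        hderF s ⟨by linarith [hs.1], by linarith [hs.2]⟩ t (hsub ht)

end FirstVariation

/-- Integration by parts for curves in a Hilbert space. -/
lemma integral_inner_deriv {E : Type*} [NormedAddCommGroup E] [InnerProductSpace ℝ E] {a b : ℝ}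
    (hab : a < b) {p p' δ δ' : ℝ → E} (hp : ∀ t ∈ Icc a b, HasDerivWithinAt p (p' t) (Icc a b) t)
    (hp' : ContinuousOn p' (Icc a b))
    (hδ : ∀ t ∈ Icc a b, HasDerivWithinAt δ (δ' t) (Icc a b) t)
    (hδ' : ContinuousOn δ' (Icc a b)) (ha : δ a = 0) (hb : δ b = 0) :
    ∫ t in a..b, inner ℝ (p t) (δ' t) = -∫ t in a..b, inner ℝ (p' t) (δ t) := by
  have hpc : ContinuousOn p (Icc a b) := fun t ht => (hp t ht).continuousWithinAt
  have hδc : ContinuousOn δ (Icc a b) := fun t ht => (hδ t ht).continuousWithinAt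
  have i1 : IntervalIntegrable (fun t => inner ℝ (p t) (δ' t)) volume a b :=
    ContinuousOn.intervalIntegrable_of_Icc hab.le (hpc.inner hδ')
  have i2 : IntervalIntegrable (fun t => inner ℝ (p' t) (δ t)) volume a b :=
    ContinuousOn.intervalIntegrable_of_Icc hab.le (hp'.inner hδc)
  have h := intervalIntegral.integral_eq_sub_of_hasDerivAt_of_le hab.le (hpc.inner hδc)
    (f' := fun t => inner ℝ (p t) (δ' t) + inner ℝ (p' t) (δ t))
    (fun t ht => ((hp t (Ioo_subset_Icc_self ht)).inner ℝ
      (hδ t (Ioo_subset_Icc_self ht))).hasDerivAt (Icc_mem_nhds ht.1 ht.2)) (i1.add i2)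
  rw [intervalIntegral.integral_add i1 i2, ha, hb, inner_zero_right, inner_zero_right] at h
  linarith

/-- The fundamental lemma of the calculus of variations. -/
lemma eq_zero_of_integral_smooth_mul {a b : ℝ} (hab : a < b) {g : ℝ → ℝ}
    (hg : ContinuousOn g (Icc a b))
    (h : ∀ χ : ℝ → ℝ, ContDiff ℝ (⊤ : ℕ∞) χ → χ a = 0 → χ b = 0 → ∫ t in a..b, χ t * g t = 0) :
    ∀ t ∈ Icc a b, g t = 0 := by
  have h1 : ∀ᵐ t, t ∈ Ioo a b → g t = 0 := by
    refine isOpen_Ioo.ae_eq_zero_of_integral_contDiff_smul_eq_zero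
      ((hg.mono Ioo_subset_Icc_self).locallyIntegrableOn measurableSet_Ioo) fun χ hχ _ hs => ?_
    have hz : ∀ t, t ∉ Ioo a b → χ t = 0 := fun t ht =>
      image_eq_zero_of_notMem_tsupport fun h => ht (hs h)
    have e := h χ hχ (hz a (by simp)) (hz b (by simp))
    rw [intervalIntegral.integral_of_le hab.le, setIntegral_eq_integral_of_forall_compl_eq_zero] at e
    · simpa using e
    · intro t ht
      rw [hz t fun h => ht (Ioo_subset_Ioc_self h), zero_mul]
  have h2 : g =ᵐ[volume.restrict (Ioo a b)] 0 := by
    rwa [EventuallyEq, ae_restrict_iff' measurableSet_Ioo]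
  have h3 : EqOn g 0 (Ioo a b) :=
    Measure.eqOn_open_of_ae_eq h2 isOpen_Ioo (hg.mono Ioo_subset_Icc_self) continuousOn_const
  intro t ht
  rw [← closure_Ioo hab.ne] at ht hg
  exact h3.of_subset_closure hg continuousOn_const subset_closure subset_rfl ht

/-! ### Geodesics of `Q` -/

lemma contDiff_hamiltonian {n : WithTop ℕ∞} : ContDiff ℝ n hamiltonian := by
  rw [show hamiltonian = _ from funext hamiltonian_eq]
  exact contDiff_const.mul (((mulL.contDiff.comp (contDiff_etaC.comp contDiff_fst)).clm_apply
    contDiff_snd).inner ℝ contDiff_snd)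

/-- The Lagrangian `½ G(q)(v, v)` of the metric of `Q`. -/
def lagrangianQ (z : L2 × L2) : ℝ := hamiltonian (-z.1, z.2)

lemma contDiff_lagrangianQ {n : WithTop ℕ∞} : ContDiff ℝ n lagrangianQ :=
  contDiff_hamiltonian.comp (contDiff_fst.neg.prodMk contDiff_snd)

/-- Since `1/η(q) = η(-q)`, the Lagrangian at `(q, v)` is the Hamiltonian at `(-q, v)`. -/
lemma energy_metricQ (a b : ℝ) (γ : ℝ → L2) : energy metricQ a b γ =
    ∫ t in a..b, lagrangianQ (γ t, derivWithin γ (Icc a b) t) := by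
  rw [energy, ← intervalIntegral.integral_const_mul]
  simp only [metricQ_eq, lagrangianQ, hamiltonian_eq]

/-- With `v = η p` one has `v²/η = η p²`. -/
lemma tailC_neg (q p : L2) : tailC (-q) (mulL (etaC q) p) = tailC q p := by
  rw [tailC, tailC, mulL_mulL, etaC_neg_mul_etaC, one_mulL, primMul_comm, real_inner_comm]

/-- The derivative of the Lagrangian, in terms of the momentum `p = q̇ / η(q)`. -/
lemma fderiv_lagrangianQ (q p h k : L2) :
    fderiv ℝ lagrangianQ (q, mulL (etaC q) p) (h, k) =
      inner ℝ p k - (1 / 2) * inner ℝ (toL (tailC q p)) h := by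
  obtain ⟨dH, hdH, e⟩ := hasFDerivAt_hamiltonian (-q) (mulL (etaC q) p)
  have h1 : HasFDerivAt (fun z : L2 × L2 => (-z.1, z.2))
      ((-ContinuousLinearMap.fst ℝ L2 L2).prod (ContinuousLinearMap.snd ℝ L2 L2))
      (q, mulL (etaC q) p) := hasFDerivAt_fst.neg.prodMk hasFDerivAt_snd
  have h2 := HasFDerivAt.comp (g := hamiltonian) (q, mulL (etaC q) p) hdH h1
  rw [show lagrangianQ = hamiltonian ∘ fun z : L2 × L2 => (-z.1, z.2) from rfl, h2.fderiv]
  change dH (-h, k) = _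
  rw [e, tailC_neg, mulL_mulL, etaC_neg_mul_etaC, one_mulL, inner_neg_right]
  ring

/-- The set `s` is the closed time interval for a curve and an open parameter interval for a
variation; unique differentiability covers both. -/
lemma isTangentQ_of_curve {c : ℝ → L2} {h : L2} {s : Set ℝ} {t : ℝ} (ht : t ∈ s)
    (hs : UniqueDiffWithinAt ℝ s t) (hc : HasDerivWithinAt c h s t) (hQ : ∀ u ∈ s, c u ∈ Q) :
    IsTangentQ (c t) h := by
  obtain ⟨D1, hD1, e1⟩ := hasFDerivAt_constraint_one (c t)
  obtain ⟨D2, hD2, e2⟩ := hasFDerivAt_constraint_eta (hQ t ht)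
  have f1 : D1 h = 0 := by
    have k1 := hD1.comp_hasDerivWithinAt t hc
    have k2 : HasDerivWithinAt ((fun q => inner ℝ oneL q) ∘ c) (0 : ℝ) s t :=
      (hasDerivWithinAt_const t s (0 : ℝ)).congr (fun u hu => (mem_Q_iff.1 (hQ u hu)).1)
        (mem_Q_iff.1 (hQ t ht)).1
    exact hs.eq_deriv _ k1 k2
  have f2 : D2 h = 0 := by
    have k1 := hD2.comp_hasDerivWithinAt t hc
    have k2 : HasDerivWithinAt ((fun q => inner ℝ oneL (toL (etaC q))) ∘ c) (0 : ℝ) s t :=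
      (hasDerivWithinAt_const t s (1 : ℝ)).congr (fun u hu => (mem_Q_iff.1 (hQ u hu)).2)
        (mem_Q_iff.1 (hQ t ht)).2
    exact hs.eq_deriv _ k1 k2
  rw [e1] at f1
  rw [e2] at f2
  exact ⟨f1, by linarith⟩

lemma isTangent_of_curve {q p : ℝ → L2} {h k : L2} {s : Set ℝ} {t : ℝ} (ht : t ∈ s)
    (hs : UniqueDiffWithinAt ℝ s t) (hq : HasDerivWithinAt q h s t)
    (hp : HasDerivWithinAt p k s t) (hQ : ∀ u ∈ s, (q u, p u) ∈ cotangentQ) :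
    IsTangent (q t) (p t) (h, k) := by
  obtain ⟨D3, hD3, e3⟩ := hasFDerivAt_constraint_mom (q t) (p t)
  obtain ⟨D4, hD4, e4⟩ := hasFDerivAt_constraint_mom_phi (q t) (p t)
  have hmem : ∀ u ∈ s, _ := fun u hu => (mem_cotangentQ_iff.1 (hQ u hu)).2
  refine ⟨isTangentQ_of_curve ht hs hq fun u hu => (hQ u hu).1, ?_, ?_⟩
  · rw [← e3]
    have k1 := HasFDerivAt.comp_hasDerivWithinAt (f := fun t => (q t, p t)) t hD3 (hq.prodMk hp)
    have k2 : HasDerivWithinAt ((fun z : L2 × L2 => inner ℝ (toL (etaC z.1)) z.2) ∘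
        fun t => (q t, p t)) (0 : ℝ) s t :=
      (hasDerivWithinAt_const t s (0 : ℝ)).congr (fun u hu => (hmem u hu).1) (hmem t ht).1
    exact hs.eq_deriv _ k1 k2
  · rw [← e4]
    have k1 := HasFDerivAt.comp_hasDerivWithinAt (f := fun t => (q t, p t)) t hD4 (hq.prodMk hp)
    have k2 : HasDerivWithinAt ((fun z : L2 × L2 => inner ℝ (toL (etaC z.1 * phiC z.1)) z.2) ∘
        fun t => (q t, p t)) (0 : ℝ) s t :=
      (hasDerivWithinAt_const t s (0 : ℝ)).congr (fun u hu => (hmem u hu).2) (hmem t ht).2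
    exact hs.eq_deriv _ k1 k2

lemma continuousOn_tailC {s : Set ℝ} {q p : ℝ → L2} (hq : ContinuousOn q s)
    (hp : ContinuousOn p s) : ContinuousOn (fun t => toL (tailC (q t) (p t))) s := by
  have h1 : ContinuousOn (fun t => etaC (q t)) s :=
    (contDiff_etaC (n := 0)).continuous.comp_continuousOn hq
  simp only [tailC]
  have h2 : ContinuousOn (fun t => mulL (etaC (q t)) (p t)) s :=
    (mulL.continuous.comp_continuousOn h1).clm_apply hp
  have h3 : ContinuousOn (fun t => inner ℝ (mulL (etaC (q t)) (p t)) (p t)) s := h2.inner hp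
  have h4 : ContinuousOn (fun t => primMul (mulL (etaC (q t)) (p t)) (p t)) s :=
    (primMul.continuous.comp_continuousOn h2).clm_apply hp
  have h5 : ContinuousOn (fun t => inner ℝ (mulL (etaC (q t)) (p t)) (p t) • (1 : CI)) s :=
    h3.smul continuousOn_const
  have h6 : ContinuousOn (fun t => inner ℝ (mulL (etaC (q t)) (p t)) (p t) • (1 : CI) -
      primMul (mulL (etaC (q t)) (p t)) (p t)) s :=
    h5.sub h4
  exact toL.continuous.comp_continuousOn h6

/-- The first variation of the energy along a variation in `Q`. -/
lemma energy_first_variation {a b ε : ℝ} (hab : a < b) (hε : 0 < ε) {q p p' : ℝ → L2}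
    (hq : ∀ t ∈ Icc a b, HasDerivWithinAt q (mulL (etaC (q t)) (p t)) (Icc a b) t)
    (hp : ∀ t ∈ Icc a b, HasDerivWithinAt p (p' t) (Icc a b) t)
    (hp' : ContinuousOn p' (Icc a b)) {Γ : ℝ → ℝ → L2} (hΓ : IsVariation Q a b q ε Γ) :
    ∃ δ : ℝ → L2, (∀ t ∈ Icc a b, HasDerivAt (fun s => Γ s t) (δ t) 0) ∧
      (∀ t ∈ Icc a b, IsTangentQ (q t) (δ t)) ∧
      HasDerivAt (fun s => energy metricQ a b (Γ s))
        (∫ t in a..b, inner ℝ (-(1 / 2 : ℝ) • toL (tailC (q t) (p t)) - p' t) (δ t)) 0 := by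
  obtain ⟨δ, δ', hδ, hδ', hδ'c, ha, hb, h⟩ :=
    first_variation hab hε hΓ (contDiff_lagrangianQ (n := 1))
  have h0 : (0 : ℝ) ∈ Ioo (-ε) ε := ⟨by linarith, hε⟩
  refine ⟨δ, hδ, fun t ht => ?_, ?_⟩
  · have := isTangentQ_of_curve (c := fun s => Γ s t) h0 (isOpen_Ioo.uniqueDiffWithinAt h0)
      (hδ t ht).hasDerivWithinAt fun s hs => hΓ.mem s hs t ht
    simpa only [hΓ.eq_zero t ht] using this
  · simp only [energy_metricQ]
    refine h.congr_deriv ?_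
    have hqc : ContinuousOn q (Icc a b) := fun t ht => (hq t ht).continuousWithinAt
    have hpc : ContinuousOn p (Icc a b) := fun t ht => (hp t ht).continuousWithinAt
    have hδc : ContinuousOn δ (Icc a b) := fun t ht => (hδ' t ht).continuousWithinAt
    have htail : ContinuousOn (fun t => -(1 / 2 : ℝ) • toL (tailC (q t) (p t))) (Icc a b) :=
      (continuousOn_tailC hqc hpc).const_smul (-(1 / 2 : ℝ))
    have e1 : ∫ t in a..b, fderiv ℝ lagrangianQ (q t, derivWithin q (Icc a b) t) (δ t, δ' t) =
        ∫ t in a..b, (inner ℝ (p t) (δ' t) +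
          inner ℝ (-(1 / 2 : ℝ) • toL (tailC (q t) (p t))) (δ t)) := by
      refine intervalIntegral.integral_congr fun t ht => ?_
      rw [uIcc_of_le hab.le] at ht
      rw [(hq t ht).derivWithin (uniqueDiffOn_Icc hab t ht), fderiv_lagrangianQ, inner_smul_left]
      simp
      ring
    have i1 : IntervalIntegrable (fun t => inner ℝ (p t) (δ' t)) volume a b :=
      ContinuousOn.intervalIntegrable_of_Icc hab.le (hpc.inner hδ'c)
    have i2 : IntervalIntegrable
        (fun t => inner ℝ (-(1 / 2 : ℝ) • toL (tailC (q t) (p t))) (δ t)) volume a b :=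
      ContinuousOn.intervalIntegrable_of_Icc hab.le (htail.inner hδc)
    have i3 : IntervalIntegrable (fun t => inner ℝ (p' t) (δ t)) volume a b :=
      ContinuousOn.intervalIntegrable_of_Icc hab.le (hp'.inner hδc)
    rw [e1, intervalIntegral.integral_add i1 i2,
      integral_inner_deriv hab hp hp' hδ' hδ'c ha hb]
    simp only [inner_sub_left]
    rw [intervalIntegral.integral_sub i2 i3]
    ring

lemma isHamiltonianSolution_iff {a b : ℝ} {q p : ℝ → L2} : IsHamiltonianSolution a b q p ↔
    ∀ t ∈ Icc a b, (q t, p t) ∈ cotangentQ ∧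
      HasDerivWithinAt q (field (q t) (p t)).1 (Icc a b) t ∧
      HasDerivWithinAt p (field (q t) (p t)).2 (Icc a b) t := by
  refine forall₂_congr fun t _ => and_congr_right fun h => ⟨?_, fun h' => ?_⟩
  · rintro ⟨X, hX, h'⟩
    rw [(isFieldAt_iff h.1 _ _).1 hX] at h'
    exact h'
  · exact ⟨_, (isFieldAt_iff h.1 _ _).2 rfl, h'⟩

lemma contDiffOn_one_of_hasDerivWithinAt {E : Type*} [NormedAddCommGroup E] [NormedSpace ℝ E]
    {a b : ℝ} (hab : a < b) {f f' : ℝ → E}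
    (hf : ∀ t ∈ Icc a b, HasDerivWithinAt f (f' t) (Icc a b) t) (hf' : ContinuousOn f' (Icc a b)) :
    ContDiffOn ℝ 1 f (Icc a b) := by
  have hu := uniqueDiffOn_Icc hab
  rw [show (1 : WithTop ℕ∞) = 0 + 1 by simp, contDiffOn_succ_iff_derivWithin hu]
  refine ⟨fun t ht => (hf t ht).differentiableWithinAt, by simp, ?_⟩
  rw [contDiffOn_zero]
  exact hf'.congr fun t ht => (hf t ht).derivWithin (hu t ht)

/-- The solutions of the system are geodesics. -/
lemma IsHamiltonianSolution.isGeodesic {a b : ℝ} (hab : a < b) {q p : ℝ → L2}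
    (h : IsHamiltonianSolution a b q p) : IsGeodesic Q metricQ a b q := by
  rw [isHamiltonianSolution_iff] at h
  have hu := uniqueDiffOn_Icc hab
  have hqc : ContinuousOn q (Icc a b) := fun t ht => (h t ht).2.1.continuousWithinAt
  have hpc : ContinuousOn p (Icc a b) := fun t ht => (h t ht).2.2.continuousWithinAt
  have hfc : ContinuousOn (fun t => field (q t) (p t)) (Icc a b) :=
    continuous_field.comp_continuousOn (hqc.prodMk hpc)
  have hp1 : ContDiffOn ℝ 1 p (Icc a b) :=
    contDiffOn_one_of_hasDerivWithinAt hab (fun t ht => (h t ht).2.2)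
      (continuous_snd.comp_continuousOn hfc)
  have hq1 : ContDiffOn ℝ 1 q (Icc a b) :=
    contDiffOn_one_of_hasDerivWithinAt hab (fun t ht => (h t ht).2.1)
      (continuous_fst.comp_continuousOn hfc)
  refine ⟨fun t ht => (h t ht).1.1, ?_, fun ε hε Γ hΓ => ?_⟩
  -- Regularity bootstrap: the field is continuous, so `q` and `p` are `C¹`; then `q̇ = η p` is
  -- `C¹`.
  · rw [show (2 : WithTop ℕ∞) = 1 + 1 by norm_num, contDiffOn_succ_iff_derivWithin hu]
    refine ⟨fun t ht => (h t ht).2.1.differentiableWithinAt, by simp, ?_⟩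
    have h1 : ContDiffOn ℝ 1 (fun t => mulL (etaC (q t)) (p t)) (Icc a b) :=
      (mulL.contDiff.comp_contDiffOn (contDiff_etaC.comp_contDiffOn hq1)).clm_apply hp1
    exact h1.congr fun t ht => (h t ht).2.1.derivWithin (hu t ht)
  · obtain ⟨δ, _, hδ, hE⟩ := energy_first_variation hab hε (fun t ht => (h t ht).2.1)
      (fun t ht => (h t ht).2.2) (continuous_snd.comp_continuousOn hfc) hΓ
    refine hE.congr_deriv ?_
    -- The integrand is the pairing of `δ` with minus the multiplier term, a combination of `1` and
    -- `φ`, and `δ` is tangent to `Q`.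
    refine (intervalIntegral.integral_congr fun t ht => ?_).trans intervalIntegral.integral_zero
    rw [uIcc_of_le hab.le] at ht
    have hδt := hδ t ht
    simp only [field, momentumC, lagrC, map_add, map_smul, toL_one, inner_sub_left,
      inner_add_left, inner_smul_left, hδt.1, hδt.2]
    simp

/-- A variation of a curve in `Q`, linear in the chart `derivEta`. -/
lemma exists_variation {a b : ℝ} {q : ℝ → L2} (hq : ContDiffOn ℝ 2 q (Icc a b))
    (hQ : ∀ t ∈ Icc a b, q t ∈ Q) {k : L2} (hk : k ∈ secondDerivSubmodule) {χ : ℝ → ℝ}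
    (hχ : ContDiff ℝ (⊤ : ℕ∞) χ) (ha : χ a = 0) (hb : χ b = 0) :
    ∃ ε > 0, ∃ Γ : ℝ → ℝ → L2, IsVariation Q a b q ε Γ ∧
      ∀ t ∈ Icc a b, HasDerivAt (fun s => Γ s t)
        (χ t • fderiv ℝ logDerivMap (derivEta (q t)) k) 0 := by
  have hdc : ContinuousOn (fun t => derivEta (q t)) (Icc a b) :=
    (contDiff_derivEta (n := 0)).continuous.comp_continuousOn hq.continuousOn
  -- The curve in the chart has compact image, hence a whole `r`-neighbourhood in the open domain of
  -- the inverse chart. With `‖χ t • k‖ ≤ |C|`, the choice `ε = r / (|C| + 1)` keeps the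
  -- perturbation below `r`.
  obtain ⟨r, hr, hrU⟩ := (isCompact_Icc.image_of_continuousOn hdc).exists_thickening_subset_open
    isOpen_isUnit_prim (by
      rintro _ ⟨t, _, rfl⟩
      exact isUnit_derivEta (q t))
  obtain ⟨C, hC⟩ := isCompact_Icc.exists_bound_of_continuousOn
    (s := Icc a b) (hχ.continuous.smul continuous_const (g := fun _ => k)).continuousOn
  have hε : 0 < r / (|C| + 1) := by positivity
  have hunit : ∀ s ∈ Ioo (-(r / (|C| + 1))) (r / (|C| + 1)), ∀ t ∈ Icc a b,
      IsUnit (1 + prim (derivEta (q t) + s • χ t • k)) := by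
    intro s hs t ht
    refine hrU (Metric.mem_thickening_iff.2 ⟨derivEta (q t), mem_image_of_mem _ ht, ?_⟩)
    rw [dist_eq_norm, add_sub_cancel_left, norm_smul]
    have h1 : ‖s‖ < r / (|C| + 1) := by rw [Real.norm_eq_abs, abs_lt]; exact hs
    have h2 : ‖χ t • k‖ ≤ |C| := (hC t ht).trans (le_abs_self C)
    rw [lt_div_iff₀ (by positivity)] at h1
    nlinarith [norm_nonneg s, abs_nonneg C, norm_nonneg (χ t • k),
      mul_le_mul_of_nonneg_left h2 (norm_nonneg s)]
  refine ⟨_, hε, fun s t => logDerivMap (derivEta (q t) + s • χ t • k), ⟨?_, ?_, ?_, ?_, ?_⟩, ?_⟩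
  · intro z hz
    have h1 : ContDiffWithinAt ℝ 2 (fun z : ℝ × ℝ => derivEta (q z.2))
        (Ioo (-(r / (|C| + 1))) (r / (|C| + 1)) ×ˢ Icc a b) z :=
      (contDiff_derivEta (n := 2)).comp_contDiffWithinAt
        ((hq z.2 hz.2).comp z contDiff_snd.contDiffWithinAt fun w hw => hw.2)
    have h2 : ContDiffWithinAt ℝ 2 (fun z : ℝ × ℝ => z.1 • χ z.2 • k)
        (Ioo (-(r / (|C| + 1))) (r / (|C| + 1)) ×ˢ Icc a b) z := by
      have h3 : ContDiff ℝ 2 χ := hχ.of_le (WithTop.coe_le_coe.2 (le_top : (2 : ℕ∞) ≤ ⊤))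
      exact (contDiff_fst.smul ((h3.comp contDiff_snd).smul contDiff_const)).contDiffWithinAt
    exact (contDiffAt_logDerivMap (hunit z.1 hz.1 z.2 hz.2)).comp_contDiffWithinAt z (h1.add h2)
  · intro s hs t ht
    refine logDerivMap_mem_Q (hunit s hs t ht) (add_mem (derivEta_mem.2 (hQ t ht)) ?_)
    exact Submodule.smul_mem _ _ (Submodule.smul_mem _ _ hk)
  · intro t _
    simp only [zero_smul, add_zero, logDerivMap_derivEta]
  · intro s _
    simp only [ha, zero_smul, smul_zero, add_zero, logDerivMap_derivEta]
  · intro s _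
    simp only [hb, zero_smul, smul_zero, add_zero, logDerivMap_derivEta]
  · intro t ht
    have hl : HasDerivAt (fun s : ℝ => derivEta (q t) + s • χ t • k) (χ t • k) 0 := by
      simpa using ((hasDerivAt_id (0 : ℝ)).smul_const (χ t • k)).const_add (derivEta (q t))
    have h2 : HasFDerivAt logDerivMap (fderiv ℝ logDerivMap (derivEta (q t)))
        (derivEta (q t) + (0 : ℝ) • χ t • k) := by
      rw [zero_smul, add_zero]
      exact (contDiffAt_logDerivMap (n := 1) (isUnit_derivEta (q t))).differentiableAt
        (by simp) |>.hasFDerivAt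
    have := h2.comp_hasDerivAt 0 hl
    rwa [map_smul] at this

/-- Geodesics solve the system. -/
lemma IsGeodesic.exists_solution {a b : ℝ} (hab : a < b) {q : ℝ → L2}
    (h : IsGeodesic Q metricQ a b q) : ∃ p : ℝ → L2, IsHamiltonianSolution a b q p := by
  have hu := uniqueDiffOn_Icc hab
  have hq1 : ContDiffOn ℝ 1 (derivWithin q (Icc a b)) (Icc a b) :=
    h.contDiffOn.derivWithin hu (by norm_num)
  set p : ℝ → L2 := fun t => mulL (etaC (-q t)) (derivWithin q (Icc a b) t) with hp
  have hpC : ContDiffOn ℝ 1 p (Icc a b) :=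
    (mulL.contDiff.comp_contDiffOn (contDiff_etaC.comp_contDiffOn
      (h.contDiffOn.of_le (by norm_num)).neg)).clm_apply hq1
  have hqd : ∀ t ∈ Icc a b, HasDerivWithinAt q (mulL (etaC (q t)) (p t)) (Icc a b) t := by
    intro t ht
    rw [hp, mulL_mulL, etaC_mul_etaC_neg, one_mulL]
    exact (h.contDiffOn.differentiableOn (by norm_num) t ht).hasDerivWithinAt
  have hpd : ∀ t ∈ Icc a b, HasDerivWithinAt p (derivWithin p (Icc a b) t) (Icc a b) t :=
    fun t ht => (hpC.differentiableOn (by norm_num) t ht).hasDerivWithinAt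
  have hp'c : ContinuousOn (derivWithin p (Icc a b)) (Icc a b) :=
    hpC.continuousOn_derivWithin hu le_rfl
  have hcot : ∀ t ∈ Icc a b, (q t, p t) ∈ cotangentQ := by
    intro t ht
    have ht' := isTangentQ_of_curve ht (hu t ht) (hqd t ht) h.mem
    refine mem_cotangentQ_iff.2 ⟨h.mem t ht, ?_, ?_⟩
    · rw [inner_toL]; exact ht'.1
    · rw [mul_comm (etaC (q t)), ← mulL_toL, inner_mulL, inner_toL, mulL_mulL,
        mul_comm (etaC (q t)), ← mulL_mulL, ← inner_toL]
      exact ht'.2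
  set e : ℝ → L2 := fun t =>
    -(1 / 2 : ℝ) • toL (tailC (q t) (p t)) - derivWithin p (Icc a b) t with he
  have hec : ContinuousOn e (Icc a b) := by
    exact ((continuousOn_tailC h.contDiffOn.continuousOn hpC.continuousOn).const_smul
      (-(1 / 2 : ℝ))).sub hp'c
  -- For a fixed direction `k` in the chart, the variations `χ(t) k` localise in time, and the
  -- fundamental lemma gives the orthogonality at every `t`.
  have hek : ∀ k ∈ secondDerivSubmodule, ∀ t ∈ Icc a b,
      inner ℝ (e t) (fderiv ℝ logDerivMap (derivEta (q t)) k) = 0 := by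
    intro k hk
    refine eq_zero_of_integral_smooth_mul hab ?_ fun χ hχ ha hb => ?_
    · refine hec.inner (ContinuousOn.clm_apply ?_ continuousOn_const)
      intro t ht
      have h1 : ContinuousAt (fderiv ℝ logDerivMap) (derivEta (q t)) :=
        ((contDiffAt_logDerivMap (n := 1) (isUnit_derivEta (q t))).fderiv_right
          (m := 0) (by simp)).continuousAt
      have h2 : ContinuousWithinAt (fun t => derivEta (q t)) (Icc a b) t :=
        (contDiff_derivEta (n := 0)).continuous.continuousAt.comp_continuousWithinAt
          (h.contDiffOn.continuousOn t ht)
      exact ContinuousAt.comp_continuousWithinAt (f := fun t => derivEta (q t)) h1 h2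
    · obtain ⟨ε, hε, Γ, hΓ, hΓd⟩ := exists_variation h.contDiffOn h.mem hk hχ ha hb
      obtain ⟨δ, hδ, _, hE⟩ := energy_first_variation hab hε hqd hpd hp'c hΓ
      rw [(h.critical ε hε Γ hΓ).unique hE]
      refine intervalIntegral.integral_congr fun t ht => ?_
      rw [uIcc_of_le hab.le] at ht
      rw [(hδ t ht).unique (hΓd t ht), inner_smul_right]
  refine ⟨p, isHamiltonianSolution_iff.2 fun t ht => ⟨hcot t ht, hqd t ht, ?_⟩⟩
  have hqt := h.mem t ht
  have horth : ∀ v, IsTangentQ (q t) v →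
      inner ℝ ((field (q t) (p t)).2 - derivWithin p (Icc a b) t) v = 0 := by
    intro v hv
    -- Every `v` tangent to `Q` arises this way, from `k` the image of `v` under the derivative of
    -- the chart.
    have h1 := hek _ (fderiv_derivEta_mem hqt hv) t ht
    rw [fderiv_logDerivMap_derivEta] at h1
    simp only [he, field, inner_sub_left, momentumC, lagrC, map_add, map_smul, toL_one, inner_add_left,
      inner_smul_left, hv.1, hv.2] at h1 ⊢
    simpa using h1
  -- The field and the velocity of the curve are both tangent to `T*Q` over the same `q̇`, so their
  -- difference satisfies the fibre constraints. Being orthogonal to `T_qQ`, it vanishes.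
  obtain ⟨c1, c2⟩ := (isTangent_field (hcot t ht)).snd_constraints
    (isTangent_of_curve ht (hu t ht) (hqd t ht) (hpd t ht) hcot)
  exact (hpd t ht).congr_deriv (sub_eq_zero.1 (eq_zero_of_orthogonal c1 c2 horth)).symm

theorem isGeodesic_Q_iff {a b : ℝ} (hab : a < b) (q : ℝ → L2) :
    IsGeodesic Q metricQ a b q ↔ ∃ p : ℝ → L2, IsHamiltonianSolution a b q p :=
  ⟨fun h => h.exists_solution hab, fun ⟨_, h⟩ => h.isGeodesic hab⟩

/-! ### Geodesics and isometries -/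

section Isometry

variable {E F : Type*} [NormedAddCommGroup E] [NormedSpace ℝ E] [NormedAddCommGroup F]
  [NormedSpace ℝ F] {M : Set E} {N : Set F} {a b ε : ℝ}

lemma energy_congr (G : E → E → E → ℝ) (hab : a < b) {c c' : ℝ → E} (h : EqOn c c' (Icc a b)) :
    energy G a b c = energy G a b c' := by
  rw [energy, energy]
  congr 1
  refine intervalIntegral.integral_congr fun t ht => ?_
  rw [uIcc_of_le hab.le] at ht
  simp only [derivWithin_congr h (h ht), h ht]

lemma energy_comp_isometry {G : E → E → E → ℝ} {G' : F → F → F → ℝ} {Φ : E → F}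
    (hΦ : ∀ x ∈ M, ContDiffAt ℝ 2 Φ x)
    (hG : ∀ x ∈ M, ∀ X, G' (Φ x) (fderiv ℝ Φ x X) (fderiv ℝ Φ x X) = G x X X) (hab : a < b)
    {c : ℝ → E} (hc : ∀ t ∈ Icc a b, c t ∈ M) (hd : DifferentiableOn ℝ c (Icc a b)) :
    energy G' a b (fun t => Φ (c t)) = energy G a b c := by
  rw [energy, energy]
  congr 1
  refine intervalIntegral.integral_congr fun t ht => ?_
  rw [uIcc_of_le hab.le] at ht
  have h : HasDerivWithinAt (fun t => Φ (c t)) (fderiv ℝ Φ (c t) (derivWithin c (Icc a b) t))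
      (Icc a b) t :=
    ((hΦ _ (hc t ht)).differentiableAt (by norm_num)).hasFDerivAt.comp_hasDerivWithinAt t
      (hd t ht).hasDerivWithinAt
  rw [h.derivWithin (uniqueDiffOn_Icc hab t ht), hG _ (hc t ht)]

lemma IsVariation.comp {Φ : E → F} (hΦ : ∀ x ∈ M, ContDiffAt ℝ 2 Φ x) (hMN : MapsTo Φ M N)
    {γ : ℝ → E} {Γ : ℝ → ℝ → E} (hΓ : IsVariation M a b γ ε Γ) :
    IsVariation N a b (fun t => Φ (γ t)) ε (fun s t => Φ (Γ s t)) where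
  contDiffOn z hz := (hΦ _ (hΓ.mem z.1 hz.1 z.2 hz.2)).comp_contDiffWithinAt z (hΓ.contDiffOn z hz)
  mem s hs t ht := hMN (hΓ.mem s hs t ht)
  eq_zero t ht := congrArg Φ (hΓ.eq_zero t ht)
  eq_left s hs := congrArg Φ (hΓ.eq_left s hs)
  eq_right s hs := congrArg Φ (hΓ.eq_right s hs)

lemma IsVariation.congr_curve (hab : a < b) {γ γ' : ℝ → E} {Γ : ℝ → ℝ → E}
    (hΓ : IsVariation M a b γ ε Γ) (h : EqOn γ γ' (Icc a b)) : IsVariation M a b γ' ε Γ where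
  contDiffOn := hΓ.contDiffOn
  mem := hΓ.mem
  eq_zero t ht := (hΓ.eq_zero t ht).trans (h ht)
  eq_left s hs := (hΓ.eq_left s hs).trans (h (left_mem_Icc.2 hab.le))
  eq_right s hs := (hΓ.eq_right s hs).trans (h (right_mem_Icc.2 hab.le))

lemma IsVariation.differentiableOn {γ : ℝ → E} {Γ : ℝ → ℝ → E} (hΓ : IsVariation M a b γ ε Γ)
    {s : ℝ} (hs : s ∈ Ioo (-ε) ε) : DifferentiableOn ℝ (Γ s) (Icc a b) := by
  have h1 : DifferentiableOn ℝ (fun t : ℝ => (s, t)) (Icc a b) := by fun_prop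
  exact (hΓ.contDiffOn.differentiableOn (by norm_num)).comp h1 fun t ht => ⟨hs, ht⟩

/-- A diffeomorphism between submanifolds which preserves the metrics preserves geodesics. -/
theorem isGeodesic_iff_of_isometry {G : E → E → E → ℝ} {G' : F → F → F → ℝ} {Φ : E → F}
    {Ψ : F → E} (hΦ : ∀ x ∈ M, ContDiffAt ℝ 2 Φ x) (hΨ : ∀ y ∈ N, ContDiffAt ℝ 2 Ψ y)
    (hMN : MapsTo Φ M N) (hNM : MapsTo Ψ N M) (hΨΦ : LeftInvOn Ψ Φ M) (hΦΨ : LeftInvOn Φ Ψ N)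
    (hG : ∀ x ∈ M, ∀ X, G' (Φ x) (fderiv ℝ Φ x X) (fderiv ℝ Φ x X) = G x X X) (hab : a < b)
    {γ : ℝ → E} (hγ : ∀ t ∈ Icc a b, γ t ∈ M) :
    IsGeodesic M G a b γ ↔ IsGeodesic N G' a b (fun t => Φ (γ t)) := by
  have hγ' : EqOn (fun t => Ψ (Φ (γ t))) γ (Icc a b) := fun t ht => hΨΦ (hγ t ht)
  have h0 : ∀ {ε : ℝ}, 0 < ε → ∀ᶠ s in 𝓝 (0 : ℝ), s ∈ Ioo (-ε) ε := fun hε =>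
    isOpen_Ioo.mem_nhds ⟨by linarith, hε⟩
  constructor
  · intro h
    refine ⟨fun t ht => hMN (hγ t ht), fun t ht =>
      (hΦ _ (hγ t ht)).comp_contDiffWithinAt t (h.contDiffOn t ht), fun ε hε Γ hΓ => ?_⟩
    -- Variations are transported back by `Ψ`. The transported one varies `Ψ ∘ Φ ∘ γ`, which agrees
    -- with `γ` only on `[a, b]`.
    have hΓ' := (hΓ.comp hΨ hNM).congr_curve hab hγ'
    refine (h.critical ε hε _ hΓ').congr_of_eventuallyEq ?_
    filter_upwards [h0 hε] with s hs
    rw [← energy_comp_isometry hΦ hG hab (hΓ'.mem s hs) (hΓ'.differentiableOn hs)]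
    exact energy_congr G' hab fun t ht => (hΦΨ (hΓ.mem s hs t ht)).symm
  · intro h
    have hc : ContDiffOn ℝ 2 (fun t => Ψ (Φ (γ t))) (Icc a b) := fun t ht =>
      (hΨ _ (h.mem t ht)).comp_contDiffWithinAt t (h.contDiffOn t ht)
    refine ⟨hγ, hc.congr fun t ht => (hγ' ht).symm, fun ε hε Γ hΓ => ?_⟩
    refine (h.critical ε hε _ (hΓ.comp hΦ hMN)).congr_of_eventuallyEq ?_
    filter_upwards [h0 hε] with s hs
    exact (energy_comp_isometry hΦ hG hab (hΓ.mem s hs) (hΓ.differentiableOn hs)).symm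

end Isometry

/-! ### The space `H₀²` as a space of second derivatives -/

lemma MemH02.apply_one {f : ℝ → ℝ} (hf : MemH02 f) : f 1 = 0 := by
  have hc : Tendsto f (𝓝[>] 1) (𝓝 (f 1)) :=
    (hf.differentiable.continuous.tendsto 1).mono_left nhdsWithin_le_nhds
  have hz : Tendsto f (𝓝[>] 1) (𝓝 0) := by
    refine tendsto_const_nhds.congr' ?_
    filter_upwards [self_mem_nhdsWithin] with x hx
    exact (hf.eq_zero x (fun h => absurd h.2 (not_le.2 hx))).symm
  exact tendsto_nhds_unique hc hz

lemma MemH02.deriv_one {f : ℝ → ℝ} (hf : MemH02 f) : deriv f 1 = 0 := by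
  have h1 : Tendsto (slope f 1) (𝓝[>] 1) (𝓝 (deriv f 1)) :=
    (hasDerivAt_iff_tendsto_slope.1 (hf.differentiable 1).hasDerivAt).mono_left
      (nhdsWithin_mono _ (fun x hx => ne_of_gt hx))
  have h0 := hf.apply_one
  have h2 : Tendsto (slope f 1) (𝓝[>] 1) (𝓝 0) := by
    refine tendsto_const_nhds.congr' ?_
    filter_upwards [self_mem_nhdsWithin] with x hx
    simp [slope_def_field, h0, hf.eq_zero x (fun h => absurd h.2 (not_le.2 hx))]
  exact tendsto_nhds_unique h1 h2

lemma coeFn_secondDeriv (f : H02) : secondDeriv f =ᵐ[μI] deriv (deriv f) :=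
  MemLp.coeFn_toLp f.memH02.memLp

lemma deriv_eq_prim (f : H02) {x : ℝ} (hx : x ∈ Icc (0 : ℝ) 1) :
    deriv f x = extI (prim (secondDeriv f)) x := by
  have hac : AbsolutelyContinuousOnInterval (deriv f) 0 x := by
    refine f.memH02.absCont.mono ?_
    rw [uIcc_of_le hx.1, uIcc_of_le zero_le_one]
    exact Icc_subset_Icc_right hx.2
  have h := hac.integral_deriv_eq_sub
  rw [f.memH02.deriv_eq_zero, sub_zero] at h
  rw [extI_prim _ hx, ← h]
  exact intervalIntegral_congr_μI (coeFn_secondDeriv f).symm zero_mem_I hx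

lemma apply_eq_prim (f : H02) {x : ℝ} (hx : x ∈ Icc (0 : ℝ) 1) :
    (f : ℝ → ℝ) x = extI (prim (toL (prim (secondDeriv f)))) x := by
  rw [extI_prim _ hx]
  have h1 : ∫ y in (0 : ℝ)..x, toL (prim (secondDeriv f)) y =
      ∫ y in (0 : ℝ)..x, extI (prim (secondDeriv f)) y :=
    intervalIntegral_congr_μI (coeFn_toL _) zero_mem_I hx
  have h2 := intervalIntegral.integral_eq_sub_of_hasDerivAt_of_le hx.1
    (f := (f : ℝ → ℝ)) (f' := extI (prim (secondDeriv f)))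
    f.memH02.differentiable.continuous.continuousOn (fun y hy => by
      rw [← deriv_eq_prim f ⟨hy.1.le, hy.2.le.trans hx.2⟩]
      exact (f.memH02.differentiable y).hasDerivAt)
    ((continuous_extI _).intervalIntegrable _ _)
  rw [h1, h2, f.memH02.apply_zero, sub_zero]

lemma secondDeriv_mem (f : H02) : secondDeriv f ∈ secondDerivSubmodule := by
  rw [mem_secondDerivSubmodule, ← prim_oneI, ← prim_oneI]
  have h1 := deriv_eq_prim f one_mem_I
  have h2 := apply_eq_prim f one_mem_I
  rw [f.memH02.deriv_one, extI_of_mem _ one_mem_I] at h1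
  rw [f.memH02.apply_one, extI_of_mem _ one_mem_I] at h2
  exact ⟨h1.symm, h2.symm⟩

lemma absCont_extI_prim (w : L2) : AbsolutelyContinuousOnInterval (extI (prim w)) 0 1 := by
  have h := absCont_primitive (integrable_L2 w)
  rw [absolutelyContinuousOnInterval_iff] at h ⊢
  intro ε hε
  obtain ⟨δ, hδ, h⟩ := h ε hε
  refine ⟨δ, hδ, fun E hE hEδ => ?_⟩
  refine (Finset.sum_congr rfl fun i hi => ?_).trans_lt (h E hE hEδ)
  have h1 := (hE.1 i hi).1
  have h2 := (hE.1 i hi).2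
  rw [uIcc_of_le zero_le_one] at h1 h2
  rw [extI_prim w h1, extI_prim w h2]

lemma ae_mem_Ioo : ∀ᵐ x ∂μI, x ∈ Ioo (0 : ℝ) 1 := by
  rw [μI, ← Measure.restrict_congr_set Ioo_ae_eq_Icc]
  exact ae_restrict_mem measurableSet_Ioo

lemma ae_hasDerivAt_extI_prim (w : L2) : ∀ᵐ x ∂μI, HasDerivAt (extI (prim w)) (w x) x := by
  filter_upwards [ae_mem_Ioo, ae_hasDerivAt_primitive (integrable_L2 w)] with x hx hx'
  refine hx'.congr_of_eventuallyEq ?_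
  filter_upwards [Icc_mem_nhds hx.1 hx.2] with y hy
  exact extI_prim w hy

/-- Integrate `w` twice from `0`; the two conditions on `w` say that the first and second primitives
vanish at `1`. -/
lemma exists_secondDeriv_eq {w : L2} (hw : w ∈ secondDerivSubmodule) :
    ∃ f : H02, secondDeriv f = w := by
  rw [mem_secondDerivSubmodule, ← prim_oneI, ← prim_oneI] at hw
  set F : ℝ → ℝ := fun x => ∫ y in (0 : ℝ)..x, extI (prim w) y with hF
  have hFd : ∀ x, HasDerivAt F (extI (prim w) x) x := fun x =>
    ((continuous_extI (prim w)).integral_hasStrictDerivAt 0 x).hasDerivAt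
  -- `extI` prolongs a function by its end values, here `0` at both ends. Hence the double primitive
  -- is differentiable on the whole line and constant, equal to `0`, on each side of `[0,1]`.
  have hleft : ∀ x ≤ 0, extI (prim w) x = 0 := fun x hx => by
    rw [extI, IccExtend_of_le_left _ _ hx, prim_apply]
    simp
  have hright : ∀ x, 1 ≤ x → extI (prim w) x = 0 := fun x hx => by
    rw [extI, IccExtend_of_right_le _ _ hx]
    exact hw.1
  have hF1 : F 1 = 0 := by
    rw [← hw.2, oneI, ← extI_of_mem _ one_mem_I, extI_prim _ one_mem_I]
    exact intervalIntegral_congr_μI (coeFn_toL _).symm zero_mem_I one_mem_I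
  have hFz : ∀ x, x ∉ Icc (0 : ℝ) 1 → F x = 0 := by
    intro x hx
    rcases lt_or_ge x 0 with h | h
    · rw [hF]
      refine (intervalIntegral.integral_congr fun y hy => ?_).trans intervalIntegral.integral_zero
      rw [uIcc_of_ge h.le] at hy
      exact hleft y hy.2
    · have h1 : 1 < x := not_le.1 fun h' => hx ⟨h, h'⟩
      have h2 : ∫ y in (1 : ℝ)..x, extI (prim w) y = 0 := by
        refine (intervalIntegral.integral_congr fun y hy => ?_).trans
          intervalIntegral.integral_zero
        rw [uIcc_of_le h1.le] at hy
        exact hright y hy.1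
      have h3 := intervalIntegral.integral_add_adjacent_intervals
        ((continuous_extI (prim w)).intervalIntegrable (μ := volume) 0 1)
        ((continuous_extI (prim w)).intervalIntegrable (μ := volume) 1 x)
      rw [h2, add_zero] at h3
      exact h3.symm.trans hF1
  have hdF : deriv F = extI (prim w) := funext fun x => (hFd x).deriv
  have hd2 : deriv (deriv F) =ᵐ[μI] w := by
    rw [hdF]
    filter_upwards [ae_hasDerivAt_extI_prim w] with x hx using hx.deriv
  have hmem : MemH02 F := ⟨hFz, fun x => (hFd x).differentiableAt, by
    rw [hdF]; exact absCont_extI_prim w, (Lp.memLp w).ae_eq hd2.symm⟩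
  refine ⟨⟨F, hmem⟩, Lp.ext ?_⟩
  exact (coeFn_secondDeriv ⟨F, hmem⟩).trans hd2

/-- The second derivative, as an isometry onto its range. -/
def secondDerivEquiv : H02 ≃ₗᵢ[ℝ] secondDerivSubmodule :=
  LinearIsometryEquiv.ofSurjective
    { toLinearMap := secondDeriv.codRestrict secondDerivSubmodule secondDeriv_mem
      norm_map' := fun _ => rfl }
    (fun w => by
      obtain ⟨f, hf⟩ := exists_secondDeriv_eq w.2
      exact ⟨f, Subtype.ext hf⟩)

lemma secondDerivEquiv_apply (f : H02) : (secondDerivEquiv f : L2) = secondDeriv f := rfl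

/-- The second derivative as a continuous linear map. -/
def secondDerivL : H02 →L[ℝ] L2 :=
  secondDerivSubmodule.subtypeL.comp (secondDerivEquiv : H02 →L[ℝ] secondDerivSubmodule)

lemma secondDerivL_apply (f : H02) : secondDerivL f = secondDeriv f := rfl

/-- Completeness provides the orthogonal projection onto the subspace. It extends the inverse of the
second derivative to a continuous linear map on all of `L²`, so that composing with `derivEta` gives
a smooth map on `L²`. -/
instance : CompleteSpace secondDerivSubmodule := by
  have h1 : IsClosed {w : L2 | inner ℝ oneL w = 0} :=
    isClosed_eq (by fun_prop) continuous_const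
  have h2 : IsClosed {w : L2 | inner ℝ oneL (toL (prim w)) = 0} :=
    isClosed_eq (by fun_prop) continuous_const
  have h : IsClosed (secondDerivSubmodule : Set L2) := h1.inter h2
  exact h.completeSpace_coe

/-- A left inverse of the second derivative. -/
def integrateTwice : L2 →L[ℝ] H02 :=
  (secondDerivEquiv.symm : secondDerivSubmodule →L[ℝ] H02).comp
    secondDerivSubmodule.orthogonalProjectionOnto

lemma secondDeriv_integrateTwice {w : L2} (hw : w ∈ secondDerivSubmodule) :
    secondDeriv (integrateTwice w) = w := by
  rw [← secondDerivEquiv_apply]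
  have h : integrateTwice w = secondDerivEquiv.symm ⟨w, hw⟩ := by
    change secondDerivEquiv.symm (secondDerivSubmodule.orthogonalProjectionOnto w) = _
    congr 1
    exact Submodule.orthogonalProjectionOnto_mem_subspace_eq_self (⟨w, hw⟩ : secondDerivSubmodule)
  rw [h, LinearIsometryEquiv.apply_symm_apply]

lemma integrateTwice_secondDeriv (f : H02) : integrateTwice (secondDeriv f) = f :=
  secondDeriv_injective (secondDeriv_integrateTwice (secondDeriv_mem f))

/-! ### The change of variables on the group of diffeomorphisms -/

lemma one_add_deriv (f : H02) {x : ℝ} (hx : x ∈ Icc (0 : ℝ) 1) :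
    1 + deriv f x = (1 + prim (secondDeriv f)) ⟨x, hx⟩ := by
  rw [deriv_eq_prim f hx, extI_of_mem _ hx]; rfl

lemma isUnit_of_mem_Diff02 {f : H02} (hf : f ∈ Diff02) : IsUnit (1 + prim (secondDeriv f)) := by
  rw [ContinuousMap.isUnit_iff_forall_ne_zero]
  rintro ⟨x, hx⟩
  rw [← one_add_deriv f hx]
  exact (hf x hx).ne'

lemma integrateTwice_mem_Diff02 {q : L2} (hq : q ∈ Q) :
    integrateTwice (derivEta q) ∈ Diff02 := by
  intro x hx
  rw [one_add_deriv _ hx, secondDeriv_integrateTwice (derivEta_mem.2 hq), ← etaC_eq, etaC_apply]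
  exact eta_pos q x

lemma hasDerivAt_toMap (f : H02) (x : ℝ) : HasDerivAt (toMap f) (1 + deriv f x) x :=
  (hasDerivAt_id x).add (f.memH02.differentiable x).hasDerivAt

/-- Almost everywhere `(1 + f') q = f''`, and `1 + f'` is a unit of `C([0,1])`. -/
lemma logDerivCoord_eq {f : H02} (hf : f ∈ Diff02) :
    logDerivCoord f = logDerivMap (secondDeriv f) := by
  have h1 : mulL (1 + prim (secondDeriv f)) (logDerivCoord f) = secondDeriv f := by
    refine Lp.ext ?_
    rw [logDerivCoord, dif_pos hf]
    filter_upwards [coeFn_mulL (1 + prim (secondDeriv f)) ((memLp_logDeriv hf).toLp _),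
      MemLp.coeFn_toLp (memLp_logDeriv hf), coeFn_secondDeriv f,
      ae_differentiableAt_of_ac f.memH02.absCont, ae_restrict_mem measurableSet_Icc]
      with x h1 h2 h3 h4 h5
    have hd : deriv (toMap f) = fun x => 1 + deriv f x := funext fun y => (hasDerivAt_toMap f y).deriv
    rw [h1, h2, h3, hd, ((h4.hasDerivAt.const_add 1).log (hf x h5).ne').deriv, extI_of_mem _ h5,
      ← one_add_deriv f h5]
    exact mul_div_cancel₀ _ (hf x h5).ne'
  have hu := isUnit_of_mem_Diff02 hf
  calc logDerivCoord f = mulL (Ring.inverse (1 + prim (secondDeriv f)))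
        (mulL (1 + prim (secondDeriv f)) (logDerivCoord f)) := by
        rw [mulL_mulL, Ring.inverse_mul_cancel _ hu, one_mulL]
    _ = logDerivMap (secondDeriv f) := by rw [h1, logDerivMap]

lemma logDerivCoord_mem_Q {f : H02} (hf : f ∈ Diff02) : logDerivCoord f ∈ Q := by
  rw [logDerivCoord_eq hf]
  exact logDerivMap_mem_Q (isUnit_of_mem_Diff02 hf) (secondDeriv_mem f)

lemma etaC_logDerivCoord {f : H02} (hf : f ∈ Diff02) :
    etaC (logDerivCoord f) = 1 + prim (secondDeriv f) := by
  rw [logDerivCoord_eq hf, etaC_logDerivMap (isUnit_of_mem_Diff02 hf)]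

lemma eta_logDerivCoord {f : H02} (hf : f ∈ Diff02) {x : ℝ} (hx : x ∈ Icc (0 : ℝ) 1) :
    eta (logDerivCoord f) x = 1 + deriv f x := by
  rw [one_add_deriv f hx, ← etaC_logDerivCoord hf, etaC_apply]

lemma phi_logDerivCoord {f : H02} (hf : f ∈ Diff02) {x : ℝ} (hx : x ∈ Icc (0 : ℝ) 1) :
    phi (logDerivCoord f) x = toMap f x := by
  rw [← extI_phiC _ hx, phiC, etaC_logDerivCoord hf, map_add, map_add, extI_add, toMap,
    apply_eq_prim f hx, toL_one, extI_prim _ hx, intervalIntegral_congr_μI coeFn_oneL zero_mem_I hx]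
  simp

/-! ### The right-invariant metric -/

lemma deriv_eq_zero_of_notMem (f : H02) {x : ℝ} (hx : x ∉ Icc (0 : ℝ) 1) : deriv f x = 0 := by
  have h : (f : ℝ → ℝ) =ᶠ[𝓝 x] fun _ => 0 := by
    filter_upwards [isClosed_Icc.isOpen_compl.mem_nhds hx] with y hy
    exact f.memH02.eq_zero y hy
  rw [h.deriv_eq, deriv_const]

lemma one_add_deriv_pos {f : H02} (hf : f ∈ Diff02) (x : ℝ) : 0 < 1 + deriv f x := by
  by_cases hx : x ∈ Icc (0 : ℝ) 1
  · exact hf x hx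
  · rw [deriv_eq_zero_of_notMem f hx]; norm_num

lemma strictMono_toMap {f : H02} (hf : f ∈ Diff02) : StrictMono (toMap f) :=
  strictMono_of_deriv_pos fun x => by
    rw [(hasDerivAt_toMap f x).deriv]; exact one_add_deriv_pos hf x

lemma surjective_toMap (f : H02) : Function.Surjective (toMap f) := by
  intro y
  by_cases hy : y ∈ Icc (0 : ℝ) 1
  · have hc : ContinuousOn (toMap f) (Icc 0 1) := fun x _ =>
      (hasDerivAt_toMap f x).continuousAt.continuousWithinAt
    have h := intermediate_value_Icc zero_le_one hc
    rw [toMap, toMap, f.memH02.apply_zero, f.memH02.apply_one, add_zero, add_zero] at h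
    obtain ⟨x, _, hx⟩ := h hy
    exact ⟨x, hx⟩
  · exact ⟨y, by rw [toMap, f.memH02.eq_zero y hy, add_zero]⟩

lemma invFun_toMap {f : H02} (hf : f ∈ Diff02) (x : ℝ) :
    Function.invFun (toMap f) (toMap f x) = x :=
  Function.leftInverse_invFun (strictMono_toMap hf).injective x

lemma continuous_invFun_toMap {f : H02} (hf : f ∈ Diff02) :
    Continuous (Function.invFun (toMap f)) := by
  have h : Function.invFun (toMap f) =
      ((strictMono_toMap hf).orderIsoOfSurjective (toMap f) (surjective_toMap f)).symm := by
    funext y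
    obtain ⟨x, rfl⟩ := surjective_toMap f y
    rw [invFun_toMap hf]
    exact (((strictMono_toMap hf).orderIsoOfSurjective (toMap f)
      (surjective_toMap f)).symm_apply_apply x).symm
  rw [h]
  exact OrderIso.continuous _

lemma hasDerivAt_invFun_toMap {f : H02} (hf : f ∈ Diff02) (x : ℝ) :
    HasDerivAt (Function.invFun (toMap f)) (1 + deriv f x)⁻¹ (toMap f x) := by
  refine HasDerivAt.of_local_left_inverse (f := toMap f) (continuous_invFun_toMap hf).continuousAt ?_
    (one_add_deriv_pos hf x).ne' (Eventually.of_forall fun y => ?_)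
  · rw [invFun_toMap hf]; exact hasDerivAt_toMap f x
  · exact Function.rightInverse_invFun (surjective_toMap f) y

lemma deriv_comp_invFun {f : H02} (hf : f ∈ Diff02) (X : H02) :
    deriv (fun y => X (Function.invFun (toMap f) y)) = fun y =>
      deriv X (Function.invFun (toMap f) y) * (1 + deriv f (Function.invFun (toMap f) y))⁻¹ := by
  funext y
  obtain ⟨x, rfl⟩ := surjective_toMap f y
  have h1 : HasDerivAt X (deriv X x) (Function.invFun (toMap f) (toMap f x)) := by
    rw [invFun_toMap hf]; exact (X.memH02.differentiable x).hasDerivAt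
  rw [invFun_toMap hf]
  exact (h1.comp _ (hasDerivAt_invFun_toMap hf x)).deriv

/-- The derivative of the change of variables. -/
def logDerivTangent (f X : H02) : L2 := fderiv ℝ logDerivMap (secondDeriv f) (secondDeriv X)

/-- The linearisation of `η(q) = 1 + f'`: a variation `X` of `f` satisfies `X' = η ∫₀ˣ Z`, where `Z`
is the variation of `q`. -/
lemma prim_logDerivTangent {f : H02} (hf : f ∈ Diff02) (X : H02) :
    prim (secondDeriv X) = etaC (logDerivCoord f) * prim (logDerivTangent f X) := by
  have hu := isUnit_of_mem_Diff02 hf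
  have h1 : HasFDerivAt logDerivMap (fderiv ℝ logDerivMap (secondDeriv f)) (secondDeriv f) :=
    (contDiffAt_logDerivMap (n := 1) hu).differentiableAt (by simp) |>.hasFDerivAt
  have h2 : HasFDerivAt derivEta (fderiv ℝ derivEta (logDerivMap (secondDeriv f)))
      (logDerivMap (secondDeriv f)) :=
    (contDiff_derivEta (n := 1)).differentiable (by simp) _ |>.hasFDerivAt
  have h3 : derivEta ∘ logDerivMap =ᶠ[𝓝 (secondDeriv f)] id := by
    filter_upwards [isOpen_isUnit_prim.mem_nhds hu] with w hw
    exact derivEta_logDerivMap hw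
  have h4 := (h2.comp _ h1).unique ((hasFDerivAt_id _).congr_of_eventuallyEq h3)
  have h5 : fderiv ℝ derivEta (logDerivMap (secondDeriv f)) (logDerivTangent f X) =
      secondDeriv X := congrArg (fun L : L2 →L[ℝ] L2 => L (secondDeriv X)) h4
  rw [logDerivCoord_eq hf, ← prim_fderiv_derivEta, h5]

/-- By the chain rule `(X ∘ φ⁻¹)' = (X'/φ') ∘ φ⁻¹`, and the quotient is just `∫₀ˣ Z`.
Differentiating once more produces `(Z/η) ∘ φ⁻¹`, without any derivative of `φ'`. -/
lemma ae_deriv2_comp_invFun {f : H02} (hf : f ∈ Diff02) (X : H02) :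
    ∀ᵐ x ∂μI, deriv (deriv fun y => X (Function.invFun (toMap f) y)) (toMap f x) =
      logDerivTangent f X x * (eta (logDerivCoord f) x)⁻¹ := by
  filter_upwards [ae_mem_Ioo, ae_hasDerivAt_extI_prim (logDerivTangent f X)] with x hx hx'
  rw [deriv_comp_invFun hf]
  -- The formula for `X'/φ'` is available on `[0,1]` only, so it holds near `φ(x)` for interior `x`,
  -- which is almost every `x`.
  have h1 : (fun y => deriv X (Function.invFun (toMap f) y) *
      (1 + deriv f (Function.invFun (toMap f) y))⁻¹) =ᶠ[𝓝 (toMap f x)]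
      fun y => extI (prim (logDerivTangent f X)) (Function.invFun (toMap f) y) := by
    have h2 : ∀ᶠ y in 𝓝 (toMap f x), Function.invFun (toMap f) y ∈ Icc (0 : ℝ) 1 := by
      refine (continuous_invFun_toMap hf).continuousAt.eventually ?_
      rw [invFun_toMap hf]
      exact Icc_mem_nhds hx.1 hx.2
    filter_upwards [h2] with y hy
    rw [deriv_eq_prim X hy, prim_logDerivTangent hf, extI_mul, extI_etaC _ hy,
      eta_logDerivCoord hf hy]
    field_simp [(hf _ hy).ne']
  have h3 : HasDerivAt (extI (prim (logDerivTangent f X))) (logDerivTangent f X x)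
      (Function.invFun (toMap f) (toMap f x)) := by rw [invFun_toMap hf]; exact hx'
  rw [h1.deriv_eq, eta_logDerivCoord hf (Ioo_subset_Icc_self hx)]
  exact (h3.comp _ (hasDerivAt_invFun_toMap hf x)).deriv

/-- The change of variables is isometric. -/
lemma metricQ_logDerivTangent {f : H02} (hf : f ∈ Diff02) (X Y : H02) :
    metricQ (logDerivCoord f) (logDerivTangent f X) (logDerivTangent f Y) =
      rightInvMetric f X Y := by
  rw [rightInvMetric, innerH02, integral_phi_one (logDerivCoord_mem_Q hf), metricQ]
  refine intervalIntegral_congr_μI ?_ zero_mem_I one_mem_I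
  filter_upwards [ae_deriv2_comp_invFun hf X, ae_deriv2_comp_invFun hf Y,
    ae_restrict_mem measurableSet_Icc] with x h1 h2 hx
  rw [phi_logDerivCoord hf hx, h1, h2]
  field_simp [(eta_pos (logDerivCoord f) x).ne']

/-- The isometry is written as `logDerivMap` of the second derivative rather than as
`logDerivCoord`, which is set to `0` off `Diff02`: smoothness at each point of `Diff02` is then
immediate. -/
lemma isGeodesic_Diff02_iff_Q {a b : ℝ} (hab : a < b) {γ : ℝ → H02}
    (hγ : ∀ t ∈ Icc a b, γ t ∈ Diff02) : IsGeodesic Diff02 rightInvMetric a b γ ↔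
      IsGeodesic Q metricQ a b (fun t => logDerivMap (secondDerivL (γ t))) := by
  have hΦ : ∀ f ∈ Diff02, ∀ n : WithTop ℕ∞,
      ContDiffAt ℝ n (fun f => logDerivMap (secondDerivL f)) f := fun f hf n =>
    (contDiffAt_logDerivMap (isUnit_of_mem_Diff02 hf)).comp f secondDerivL.contDiff.contDiffAt
  refine isGeodesic_iff_of_isometry (Φ := fun f => logDerivMap (secondDerivL f))
    (Ψ := fun q => integrateTwice (derivEta q)) (fun f hf => hΦ f hf 2)
    (fun q _ => (integrateTwice.contDiff.comp contDiff_derivEta).contDiffAt)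
    (fun f hf => ?_) (fun q hq => integrateTwice_mem_Diff02 hq) (fun f hf => ?_) (fun q hq => ?_)
    (fun f hf X => ?_) hab hγ
  · exact logDerivMap_mem_Q (isUnit_of_mem_Diff02 hf) (secondDeriv_mem f)
  · simp only [secondDerivL_apply]
    rw [derivEta_logDerivMap (isUnit_of_mem_Diff02 hf), integrateTwice_secondDeriv]
  · simp only [secondDerivL_apply]
    rw [secondDeriv_integrateTwice (derivEta_mem.2 hq), logDerivMap_derivEta]
  · have h1 : HasFDerivAt logDerivMap (fderiv ℝ logDerivMap (secondDerivL f)) (secondDerivL f) :=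
      (contDiffAt_logDerivMap (n := 1)
        (isUnit_of_mem_Diff02 hf)).differentiableAt (by simp) |>.hasFDerivAt
    have h2 : HasFDerivAt (fun f => logDerivMap (secondDerivL f)) _ f :=
      h1.comp f secondDerivL.hasFDerivAt
    rw [h2.fderiv, ← metricQ_logDerivTangent hf, logDerivCoord_eq hf]
    rfl

lemma IsHamiltonianSolution.congr {a b : ℝ} {q q' p : ℝ → L2} (h : EqOn q q' (Icc a b))
    (hq : IsHamiltonianSolution a b q p) : IsHamiltonianSolution a b q' p := by
  intro t ht
  obtain ⟨h1, X, h2, h3, h4⟩ := hq t ht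
  rw [h ht] at h1 h2
  exact ⟨h1, X, h2, h3.congr (fun u hu => (h hu).symm) (h ht).symm, h4⟩

theorem isGeodesic_Diff02_iff {a b : ℝ} (hab : a < b) {γ : ℝ → H02}
    (hγ : ∀ t ∈ Icc a b, γ t ∈ Diff02) : IsGeodesic Diff02 rightInvMetric a b γ ↔
      ∃ p : ℝ → L2, IsHamiltonianSolution a b (fun t => logDerivCoord (γ t)) p := by
  rw [isGeodesic_Diff02_iff_Q hab hγ, isGeodesic_Q_iff hab]
  have h : EqOn (fun t => logDerivMap (secondDerivL (γ t))) (fun t => logDerivCoord (γ t))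
      (Icc a b) := fun t ht => (logDerivCoord_eq (hγ t ht)).symm
  exact exists_congr fun p => ⟨fun hp => hp.congr h, fun hp => hp.congr h.symm⟩

end DiffGeodesics

end

/-! ### The main theorem -/

open DiffGeodesics in
theorem mainTheorem6 :
    -- the change of variable
    (∀ f ∈ Diff02, logDerivCoord f ∈ Q ∧
      ∀ x ∈ Icc (0 : ℝ) 1, phi (logDerivCoord f) x = toMap f x) ∧
    -- geodesics of the right-invariant metric on the group of diffeomorphisms
    (∀ a b : ℝ, a < b → ∀ γ : ℝ → H02, (∀ t ∈ Icc a b, γ t ∈ Diff02) →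
      (IsGeodesic Diff02 rightInvMetric a b γ ↔
        ∃ p : ℝ → L2, IsHamiltonianSolution a b (fun t => logDerivCoord (γ t)) p)) ∧
    -- geodesics of the submanifold of `L²([0,1])`
    (∀ a b : ℝ, a < b → ∀ q : ℝ → L2,
      (IsGeodesic Q metricQ a b q ↔ ∃ p : ℝ → L2, IsHamiltonianSolution a b q p)) ∧
    -- the system is the Hamiltonian system of the kinetic energy on the cotangent bundle
    (∀ q p : L2, (q, p) ∈ cotangentQ →
      ∃ dH : (L2 × L2) →L[ℝ] ℝ, HasFDerivAt hamiltonian dH (q, p) ∧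
        ∃ X ∈ tangentConeAt ℝ cotangentQ (q, p), IsFieldAt q p X ∧
          ∀ V ∈ tangentConeAt ℝ cotangentQ (q, p),
            (∀ W ∈ tangentConeAt ℝ cotangentQ (q, p), symplecticForm V W = dH W) ↔ V = X) := by
  refine ⟨fun f hf => ⟨logDerivCoord_mem_Q hf, fun x hx => phi_logDerivCoord hf hx⟩,
    fun a b hab γ hγ => isGeodesic_Diff02_iff hab hγ, fun a b hab q => isGeodesic_Q_iff hab q,
    fun q p h => hamiltonian_vectorField h⟩
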